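/- For $n\ge 1$ let $B_n=\langle \sigma_1,\dots,\sigma_{n-1}\mid \sigma_i\sigma_j=\sigma_j\sigma_i\ (|i-j|\ge 2),\ \sigma_i\sigma_j\sigma_i=\sigma_j\sigma_i\sigma_j\ (|i-j|=1)\rangle$ be the braid group, let $P_n$ be the kernel of the homomorphism $B_n\to S_n$, $\sigma_i\mapsto(i,i+1)$, and let $e:B_n\to\mathbb Z$ be the exponent sum, i.e. the homomorphism with $e(\sigma_i)=1$ for all $i$. A braid system of degree $m$ and length $n$ is an element $\mathcal S=(\beta_1,\dots,\beta_n)\in B_m^n$. The Hurwitz action is the right action of $B_n$ on $B_m^n$ given by \[(\beta_1,\dots,\beta_n)\cdot\sigma_i=(\beta_1,\dots,\beta_{i-1},\ \beta_{i+1},\ \beta_{i+1}^{-1}\beta_i\beta_{i+1},\ \beta_{i+2},\dots,\beta_n),\] and $\mathcal S\cdot B_n$ is the Hurwitz orbit of $\mathcal S$. The system $\mathcal S$ is reducible if $\{1,\dots,n\}$ is the disjoint union of two non-empty sets $I,J$ with $\beta_i\beta_j=\beta_j\beta_i$ for all $i\in I$, $j\in J$, and irreducible otherwise. **Proposition.**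 Let $\mathcal S=(\beta_1,\beta_2,\beta_3,\beta_4)$ be an irreducible braid system of degree $3$ and length $4$ whose Hurwitz orbit $\mathcal S\cdot B_4$ is finite. Then $\#(\mathcal S\cdot B_4)\le 648$. If moreover $3\nmid e(\beta_1)+e(\beta_2)+e(\beta_3)+e(\beta_4)$, then the $P_4$-orbit of $\mathcal S$ is a quotient of the $P_4$-orbit of $(\sigma_1,\sigma_1,\sigma_1,\sigma_2)\in B_3^4$, that is, there is a surjection $(\sigma_1,\sigma_1,\sigma_1,\sigma_2)\cdot P_4\to\mathcal S\cdot P_4$ that commutes with the action of $P_4$. The set $(\sigma_1,\sigma_1,\sigma_1,\sigma_2)\cdot P_4$ has exactly $27$ elements. -/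

import Mathlib

/-- The relators of the standard presentation of the braid group on `n` strands. The generator
`σ_{k+1}` is represented by the element `k` of `Fin (n - 1)`. -/
def braidRelators (n : ℕ) : Set (FreeGroup (Fin (n - 1))) :=
  {r | ∃ i j : Fin (n - 1), (i : ℕ) + 2 ≤ (j : ℕ) ∧
      r = (FreeGroup.of i * FreeGroup.of j) * (FreeGroup.of j * FreeGroup.of i)⁻¹} ∪
  {r | ∃ i j : Fin (n - 1), (i : ℕ) + 1 = (j : ℕ) ∧
      r = (FreeGroup.of i * FreeGroup.of j * FreeGroup.of i) *
        (FreeGroup.of j * FreeGroup.of i * FreeGroup.of j)⁻¹}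

/-- Artin's braid group `B_n` on `n` strands. -/
abbrev BraidGroup (n : ℕ) : Type := PresentedGroup (braidRelators n)

/-- The standard generators of `B_n`, numbered from `0`: `BraidGroup.σ n k` is `σ_{k+1}`. -/
def BraidGroup.σ (n : ℕ) (i : Fin (n - 1)) : BraidGroup n := PresentedGroup.of i

/-- A map on the generators satisfying the braid relations extends to a homomorphism. -/
def BraidGroup.lift {n : ℕ} {H : Type*} [Group H] (f : Fin (n - 1) → H)
    (hcomm : ∀ i j : Fin (n - 1), (i : ℕ) + 2 ≤ (j : ℕ) → f i * f j = f j * f i)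
    (hbraid : ∀ i j : Fin (n - 1), (i : ℕ) + 1 = (j : ℕ) →
      f i * f j * f i = f j * f i * f j) : BraidGroup n →* H :=
  PresentedGroup.toGroup (f := f) (by
    rintro r (⟨i, j, hij, rfl⟩ | ⟨i, j, hij, rfl⟩)
    · simp only [map_mul, map_inv, FreeGroup.lift_apply_of]
      rw [hcomm i j hij, mul_inv_cancel]
    · simp only [map_mul, map_inv, FreeGroup.lift_apply_of]
      rw [hbraid i j hij, mul_inv_cancel])

theorem BraidGroup.lift_σ {n : ℕ} {H : Type*} [Group H] (f : Fin (n - 1) → H)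
    (hcomm : ∀ i j : Fin (n - 1), (i : ℕ) + 2 ≤ (j : ℕ) → f i * f j = f j * f i)
    (hbraid : ∀ i j : Fin (n - 1), (i : ℕ) + 1 = (j : ℕ) →
      f i * f j * f i = f j * f i * f j) (i : Fin (n - 1)) :
    BraidGroup.lift f hcomm hbraid (BraidGroup.σ n i) = f i :=
  PresentedGroup.toGroup.of _

/-- The strand position `i` (counted from `0`) attached to the generator `i`. -/
def BraidGroup.lo {n : ℕ} (i : Fin (n - 1)) : Fin n := ⟨i, by omega⟩

/-- The strand position `i + 1` (counted from `0`) attached to the generator `i`. -/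
def BraidGroup.hi {n : ℕ} (i : Fin (n - 1)) : Fin n := ⟨i + 1, by omega⟩

/-- The natural projection `π : B_n → S_n`, sending `σ_i` to the transposition `(i, i+1)`. -/
def BraidGroup.toPerm (n : ℕ) : BraidGroup n →* Equiv.Perm (Fin n) :=
  BraidGroup.lift (fun i => Equiv.swap (BraidGroup.lo i) (BraidGroup.hi i))
    (by
      intro i j hij
      apply Equiv.Perm.Disjoint.commute
      intro k
      by_cases h : k = BraidGroup.lo i ∨ k = BraidGroup.hi i
      · right
        apply Equiv.swap_apply_of_ne_of_ne <;>
          (rintro rfl; simp only [BraidGroup.lo, BraidGroup.hi, Fin.ext_iff] at h; omega)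
      · left
        rw [not_or] at h
        exact Equiv.swap_apply_of_ne_of_ne h.1 h.2)
    (by
      intro i j hij
      have e : BraidGroup.lo j = BraidGroup.hi i := by
        simp only [BraidGroup.lo, BraidGroup.hi, Fin.ext_iff]; omega
      have a1 : BraidGroup.lo i ≠ BraidGroup.hi i := by
        simp [BraidGroup.lo, BraidGroup.hi, Fin.ext_iff]
      have a2 : BraidGroup.lo i ≠ BraidGroup.hi j := by
        simp only [BraidGroup.lo, BraidGroup.hi, ne_eq, Fin.ext_iff]; omega
      have a3 : BraidGroup.hi i ≠ BraidGroup.hi j := by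
        simp only [BraidGroup.hi, ne_eq, Fin.ext_iff]; omega
      have h1 := Equiv.swap_mul_swap_mul_swap a3.symm a2.symm
      have h2 := Equiv.swap_mul_swap_mul_swap a1 a2
      rw [Equiv.swap_comm (BraidGroup.hi i) (BraidGroup.lo i),
        Equiv.swap_comm (BraidGroup.hi j) (BraidGroup.hi i)] at h1
      rw [e, h1, h2, Equiv.swap_comm])

/-- The pure braid group `P_n`, the kernel of `π : B_n → S_n`. -/
def pureBraidGroup (n : ℕ) : Subgroup (BraidGroup n) := (BraidGroup.toPerm n).ker

/-- The exponent sum `B_n → ℤ`, written multiplicatively, sending each `σ_i` to `1 ∈ ℤ`. -/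
def BraidGroup.exponentHom (n : ℕ) : BraidGroup n →* Multiplicative ℤ :=
  BraidGroup.lift (fun _ => Multiplicative.ofAdd (1 : ℤ)) (fun _ _ _ => rfl) (fun _ _ _ => rfl)

/-- The exponent sum `e(β)` of a braid. -/
def BraidGroup.exponentSum {n : ℕ} (b : BraidGroup n) : ℤ :=
  Multiplicative.toAdd (BraidGroup.exponentHom n b)

/-- The elementary Hurwitz move: the entries `(a, b)` at the positions `i`, `i + 1` are replaced
by `(b, b⁻¹ a b)`, and the other entries stay. -/
def hurwitzMove {G : Type*} [Group G] {n : ℕ} (i : Fin (n - 1)) : Equiv.Perm (Fin n → G) where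
  toFun s k :=
    if k = BraidGroup.lo i then s (BraidGroup.hi i)
    else if k = BraidGroup.hi i then
      (s (BraidGroup.hi i))⁻¹ * s (BraidGroup.lo i) * s (BraidGroup.hi i)
    else s k
  invFun s k :=
    if k = BraidGroup.lo i then
      s (BraidGroup.lo i) * s (BraidGroup.hi i) * (s (BraidGroup.lo i))⁻¹
    else if k = BraidGroup.hi i then s (BraidGroup.lo i)
    else s k
  left_inv s := by
    funext k
    by_cases h1 : k = BraidGroup.lo i
    · subst h1; simp [BraidGroup.lo, BraidGroup.hi, mul_assoc]
    · by_cases h2 : k = BraidGroup.hi i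
      · subst h2; simp [BraidGroup.lo, BraidGroup.hi]
      · simp [h1, h2]
  right_inv s := by
    funext k
    by_cases h1 : k = BraidGroup.lo i
    · subst h1; simp [BraidGroup.lo, BraidGroup.hi]
    · by_cases h2 : k = BraidGroup.hi i
      · subst h2; simp [BraidGroup.lo, BraidGroup.hi, mul_assoc]
      · simp [h1, h2]

theorem hurwitzMove_apply {G : Type*} [Group G] {n : ℕ} (i : Fin (n - 1)) (s : Fin n → G)
    (k : Fin n) :
    hurwitzMove i s k =
      if k = BraidGroup.lo i then s (BraidGroup.hi i)
      else if k = BraidGroup.hi i then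
        (s (BraidGroup.hi i))⁻¹ * s (BraidGroup.lo i) * s (BraidGroup.hi i)
      else s k := rfl

set_option linter.unusedSimpArgs false in
theorem hurwitzMove_comm {G : Type*} [Group G] {n : ℕ} (i j : Fin (n - 1))
    (hij : (i : ℕ) + 2 ≤ (j : ℕ)) (s : Fin n → G) :
    hurwitzMove i (hurwitzMove j s) = hurwitzMove j (hurwitzMove i s) := by
  have a1 : BraidGroup.lo i ≠ BraidGroup.lo j := by simp [BraidGroup.lo, Fin.ext_iff]; omega
  have a2 : BraidGroup.lo i ≠ BraidGroup.hi j := by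
    simp [BraidGroup.lo, BraidGroup.hi, Fin.ext_iff]; omega
  have a3 : BraidGroup.hi i ≠ BraidGroup.lo j := by
    simp [BraidGroup.lo, BraidGroup.hi, Fin.ext_iff]; omega
  have a4 : BraidGroup.hi i ≠ BraidGroup.hi j := by simp [BraidGroup.hi, Fin.ext_iff]; omega
  funext k
  simp only [hurwitzMove_apply]
  by_cases h1 : k = BraidGroup.lo i
  · subst h1; simp [a1, a2, a3, a4, a1.symm, a2.symm, a3.symm, a4.symm]
  · by_cases h2 : k = BraidGroup.hi i
    · subst h2; simp [a1, a2, a3, a4, a1.symm, a2.symm, a3.symm, a4.symm]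
    · simp [h1, h2, a1.symm, a2.symm, a3.symm, a4.symm]

set_option linter.unusedSimpArgs false in
theorem hurwitzMove_braid {G : Type*} [Group G] {n : ℕ} (i j : Fin (n - 1))
    (hij : (i : ℕ) + 1 = (j : ℕ)) (s : Fin n → G) :
    hurwitzMove i (hurwitzMove j (hurwitzMove i s)) =
      hurwitzMove j (hurwitzMove i (hurwitzMove j s)) := by
  have e : BraidGroup.lo j = BraidGroup.hi i := by
    simp [BraidGroup.lo, BraidGroup.hi, Fin.ext_iff]; omega
  have a1 : BraidGroup.lo i ≠ BraidGroup.hi i := by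
    simp [BraidGroup.lo, BraidGroup.hi, Fin.ext_iff]
  have a2 : BraidGroup.lo i ≠ BraidGroup.hi j := by
    simp [BraidGroup.lo, BraidGroup.hi, Fin.ext_iff]; omega
  have a3 : BraidGroup.hi i ≠ BraidGroup.hi j := by simp [BraidGroup.hi, Fin.ext_iff]; omega
  funext k
  simp only [hurwitzMove_apply, e]
  by_cases h1 : k = BraidGroup.lo i
  · subst h1; simp [a1, a2, a3, a1.symm, a2.symm, a3.symm]
  · by_cases h2 : k = BraidGroup.hi i
    · subst h2; simp [a1, a2, a3, a1.symm, a2.symm, a3.symm]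
    · by_cases h3 : k = BraidGroup.hi j
      · subst h3; simp [a1, a2, a3, a1.symm, a2.symm, a3.symm, mul_assoc]
      · simp [h1, h2, h3]

/-- The Hurwitz action as a homomorphism to the opposite of the permutation group
(it is a right action). -/
def hurwitzHom (G : Type*) [Group G] (n : ℕ) :
    BraidGroup n →* (Equiv.Perm (Fin n → G))ᵐᵒᵖ :=
  BraidGroup.lift (fun i => MulOpposite.op (hurwitzMove i))
    (by
      intro i j hij
      apply MulOpposite.unop_injective
      ext1 s
      exact (hurwitzMove_comm i j hij s).symm)
    (by
      intro i j hij
      apply MulOpposite.unop_injective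
      ext1 s
      exact hurwitzMove_braid i j hij s)

/-- A braid system of degree `m` and length `n`. -/
abbrev BraidSystem (m n : ℕ) : Type := Fin n → BraidGroup m

/-- The Hurwitz action `s · b` of a braid `b ∈ B_n` on a system `s` of length `n`. -/
def hurwitz {G : Type*} [Group G] {n : ℕ} (s : Fin n → G) (b : BraidGroup n) : Fin n → G :=
  (hurwitzHom G n b).unop s

theorem hurwitz_mul {G : Type*} [Group G] {n : ℕ} (s : Fin n → G) (a b : BraidGroup n) :
    hurwitz s (a * b) = hurwitz (hurwitz s a) b := by
  simp [hurwitz]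

theorem hurwitz_σ {G : Type*} [Group G] {n : ℕ} (s : Fin n → G) (i : Fin (n - 1)) :
    hurwitz s (BraidGroup.σ n i) = hurwitzMove i s := by
  simp [hurwitz, hurwitzHom, BraidGroup.lift_σ]

/-- The Hurwitz orbit `s · B_n`. -/
def hurwitzOrbit {m n : ℕ} (s : BraidSystem m n) : Set (BraidSystem m n) :=
  {x | ∃ b : BraidGroup n, x = hurwitz s b}

/-- The orbit `s · P_n` under the pure braid group. -/
def pureHurwitzOrbit {m n : ℕ} (s : BraidSystem m n) : Set (BraidSystem m n) :=
  {x | ∃ p ∈ pureBraidGroup n, x = hurwitz s p}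

/-- A braid system is reducible if its indices can be split into two non-empty parts such that
the entries of the one part commute with the entries of the other. -/
def BraidSystem.IsReducible {m n : ℕ} (s : BraidSystem m n) : Prop :=
  ∃ I : Set (Fin n), I.Nonempty ∧ Iᶜ.Nonempty ∧ ∀ i ∈ I, ∀ j ∈ Iᶜ, s i * s j = s j * s i

/-- The `P_n`-orbit of `s` is a quotient of the `P_n`-orbit of `t`: there is a surjection
`t · P_n → s · P_n` which commutes with the action of `P_n`. -/
def PureOrbitIsQuotient {m n : ℕ} (s t : BraidSystem m n) : Prop :=
  ∃ f : BraidSystem m n → BraidSystem m n,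
    f '' pureHurwitzOrbit t = pureHurwitzOrbit s ∧
    ∀ x ∈ pureHurwitzOrbit t, ∀ p ∈ pureBraidGroup n, f (hurwitz x p) = hurwitz (f x) p

/-- The braid system `(σ₁, σ₁, σ₁, σ₂)` of degree `3` and length `4`. -/
def modelSystem : BraidSystem 3 4 :=
  ![BraidGroup.σ 3 0, BraidGroup.σ 3 0, BraidGroup.σ 3 0, BraidGroup.σ 3 1]

/-! The quotient of `B_3` by the subgroup generated by `Δ₃ ^ 2` is the modular group `PSL(2, ℤ)`.
Since `Δ₃ ^ 2` has exponent sum 6, a braid is determined by its image in `PSL(2, ℤ)` and its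
exponent sum (`eq_of_toPSL_eq`). Hurwitz moves only permute exponent sums, so the problem moves to
`PSL(2, ℤ)`, where commuting is transitive through non-trivial elements.

A full twist on adjacent entries conjugates them by their product. A finite orbit makes some power
of that product commute with these entries; if they do not all commute, the power is trivial, so the
product is trivial or elliptic (of order two or three). The inequality tr[X, Y] ≥ 3 for
non-commuting X, Y with Y elliptic (`five_le_kappa`) forbids two non-commuting elliptic elements
from having an elliptic product. These two facts leave two cases (`isBraidType_or_isDihedralType`).

Braid type: the orbit contains (u, v, u, v) with uvu = vuv. The tuple is then the image, under a
homomorphism from `B_3`, of a system in the orbit of the model, which has 27 elements by explicit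
enumeration. The 24 arrangements of the exponent sums give 27 · 24 = 648. A pure braid moves no
exponent sum, so the pure orbit is a quotient of the model one.

Dihedral type: the orbit contains three commuting elements and an involution inverting them.
Counting positions and signs bounds the orbit by 4! · 2³ = 192. The square of the total product is a
power of `Δ₃ ^ 2`, so 2e = 6k and 3 divides e; the hypothesis on e therefore excludes this type. -/

open scoped MatrixGroups

/-! ### Traces, commutators and the centre of SL(2, ℤ) -/

namespace SL2Z

theorem det_eq (X : SL(2, ℤ)) : X 0 0 * X 1 1 - X 0 1 * X 1 0 = 1 := by
  have := X.det_coe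
  rwa [Matrix.det_fin_two] at this

/-- The trace of an integral matrix of determinant one. -/
def tr (X : SL(2, ℤ)) : ℤ := X 0 0 + X 1 1

theorem mul_00 (X Y : SL(2, ℤ)) : (X * Y) 0 0 = X 0 0 * Y 0 0 + X 0 1 * Y 1 0 := by
  simp [Matrix.mul_apply, Fin.sum_univ_two]
theorem mul_01 (X Y : SL(2, ℤ)) : (X * Y) 0 1 = X 0 0 * Y 0 1 + X 0 1 * Y 1 1 := by
  simp [Matrix.mul_apply, Fin.sum_univ_two]
theorem mul_10 (X Y : SL(2, ℤ)) : (X * Y) 1 0 = X 1 0 * Y 0 0 + X 1 1 * Y 1 0 := by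
  simp [Matrix.mul_apply, Fin.sum_univ_two]
theorem mul_11 (X Y : SL(2, ℤ)) : (X * Y) 1 1 = X 1 0 * Y 0 1 + X 1 1 * Y 1 1 := by
  simp [Matrix.mul_apply, Fin.sum_univ_two]

theorem inv_00 (X : SL(2, ℤ)) : X⁻¹ 0 0 = X 1 1 := by simp [Matrix.SpecialLinearGroup.SL2_inv_expl]
theorem inv_01 (X : SL(2, ℤ)) : X⁻¹ 0 1 = -X 0 1 := by simp [Matrix.SpecialLinearGroup.SL2_inv_expl]
theorem inv_10 (X : SL(2, ℤ)) : X⁻¹ 1 0 = -X 1 0 := by simp [Matrix.SpecialLinearGroup.SL2_inv_expl]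
theorem inv_11 (X : SL(2, ℤ)) : X⁻¹ 1 1 = X 0 0 := by simp [Matrix.SpecialLinearGroup.SL2_inv_expl]

theorem one_00 : (1 : SL(2, ℤ)) 0 0 = 1 := by simp
theorem one_01 : (1 : SL(2, ℤ)) 0 1 = 0 := by simp
theorem one_10 : (1 : SL(2, ℤ)) 1 0 = 0 := by simp
theorem one_11 : (1 : SL(2, ℤ)) 1 1 = 1 := by simp

theorem neg_apply (X : SL(2, ℤ)) (i j : Fin 2) : (-X) i j = -X i j := by simp

theorem ext_iff4 {X Y : SL(2, ℤ)} :
    X = Y ↔ X 0 0 = Y 0 0 ∧ X 0 1 = Y 0 1 ∧ X 1 0 = Y 1 0 ∧ X 1 1 = Y 1 1 := by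
  constructor
  · rintro rfl; simp
  · rintro ⟨h1, h2, h3, h4⟩
    ext i j
    fin_cases i <;> fin_cases j <;> assumption

theorem commute_iff {X Y : SL(2, ℤ)} :
    Commute X Y ↔ X 0 1 * Y 1 0 = X 1 0 * Y 0 1 ∧
      X 0 1 * (Y 0 0 - Y 1 1) = Y 0 1 * (X 0 0 - X 1 1) ∧
      X 1 0 * (Y 0 0 - Y 1 1) = Y 1 0 * (X 0 0 - X 1 1) := by
  rw [Commute, SemiconjBy, ext_iff4]
  simp only [mul_00, mul_01, mul_10, mul_11]
  constructor
  · rintro ⟨h1, h2, h3, h4⟩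
    refine ⟨by linarith, by linarith, by linarith⟩
  · rintro ⟨h1, h2, h3⟩
    refine ⟨by linarith, by linarith, by linarith, by linarith⟩

/-- The trace of the commutator of `X` and `Y`, plus two. -/
def kappa (X Y : SL(2, ℤ)) : ℤ := tr X ^ 2 + tr Y ^ 2 + tr (X * Y) ^ 2 - tr X * tr Y * tr (X * Y)

/-- The three differences are, up to sign, the entries of XY − YX, and the right-hand side is 4 −
det(XY − YX). -/
theorem kappa_eq (X Y : SL(2, ℤ)) :
    kappa X Y = 4 + (X 0 1 * Y 1 0 - X 1 0 * Y 0 1) ^ 2 -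
      (X 0 1 * (Y 0 0 - Y 1 1) - Y 0 1 * (X 0 0 - X 1 1)) *
      (X 1 0 * (Y 0 0 - Y 1 1) - Y 1 0 * (X 0 0 - X 1 1)) := by
  have hX := det_eq X
  have hY := det_eq Y
  simp only [kappa, tr, mul_00, mul_11]
  generalize X 0 0 = a at *
  generalize X 0 1 = b at *
  generalize X 1 0 = c at *
  generalize X 1 1 = d at *
  generalize Y 0 0 = p at *
  generalize Y 0 1 = q at *
  generalize Y 1 0 = r at *
  generalize Y 1 1 = s at *
  linear_combination (4 - (p + s) ^ 2 + 4 * (p * s - q * r - 1)) * hX + (4 - (a + d) ^ 2) * hY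

theorem kappa_eq_four {X Y : SL(2, ℤ)} (h : Commute X Y) : kappa X Y = 4 := by
  obtain ⟨h1, h2, h3⟩ := commute_iff.1 h
  rw [kappa_eq, h1, h2]
  ring

/-- On traceless matrices −det is a form of signature (2, 1), negative on the traceless part of an
elliptic Y. The commutator XY − YX is orthogonal to Y, so it lies where the form is positive
definite; hence `kappa` exceeds 4 unless the commutator vanishes. -/
theorem five_le_kappa {X Y : SL(2, ℤ)} (hY : |tr Y| ≤ 1) (h : ¬ Commute X Y) :
    5 ≤ kappa X Y := by
  by_contra hlt
  apply h
  have hk := kappa_eq X Y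
  have hd := det_eq Y
  rw [commute_iff]
  -- This is tr((XY − YX)Y) = 0, the orthogonality in coordinates.
  have ho : (X 0 1 * Y 1 0 - X 1 0 * Y 0 1) * (Y 0 0 - Y 1 1) -
      (X 0 1 * (Y 0 0 - Y 1 1) - Y 0 1 * (X 0 0 - X 1 1)) * Y 1 0 +
      (X 1 0 * (Y 0 0 - Y 1 1) - Y 1 0 * (X 0 0 - X 1 1)) * Y 0 1 = 0 := by ring
  have hdisc : (Y 0 0 - Y 1 1) ^ 2 + 4 * (Y 0 1 * Y 1 0) < 0 := by
    have : tr Y ^ 2 ≤ 1 := by rw [sq_le_one_iff_abs_le_one]; exact hY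
    rw [tr] at this
    nlinarith
  generalize hk1 : X 0 1 * Y 1 0 - X 1 0 * Y 0 1 = k1 at *
  generalize hk2 : X 0 1 * (Y 0 0 - Y 1 1) - Y 0 1 * (X 0 0 - X 1 1) = k2 at *
  generalize hk3 : X 1 0 * (Y 0 0 - Y 1 1) - Y 1 0 * (X 0 0 - X 1 1) = k3 at *
  generalize Y 0 0 - Y 1 1 = e at *
  generalize Y 0 1 = q at *
  generalize Y 1 0 = r at *
  have hq : q ≠ 0 := by rintro rfl; nlinarith [sq_nonneg e]
  have hle : k1 ^ 2 - k2 * k3 ≤ 0 := by linarith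
  -- Completing the square after eliminating k3 with `ho`: both terms on the right are non-negative
  -- since the discriminant of Y is negative.
  have hid : 4 * q ^ 2 * (k1 ^ 2 - k2 * k3) =
      (2 * q * k1 + k2 * e) ^ 2 - k2 ^ 2 * (e ^ 2 + 4 * (q * r)) := by
    linear_combination (-4 * q * k2) * ho
  have hq2 : 0 < q ^ 2 := by positivity
  have h1 : k2 = 0 := by
    by_contra h2
    have : 0 < k2 ^ 2 := by positivity
    nlinarith [sq_nonneg (2 * q * k1 + k2 * e)]
  subst h1
  have h1 : k1 = 0 := by
    have : k1 ^ 2 ≤ 0 := by nlinarith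
    exact pow_eq_zero_iff two_ne_zero |>.1 (le_antisymm this (sq_nonneg _))
  subst h1
  have h3 : k3 = 0 := by
    have : k3 * q = 0 := by linarith
    exact (mul_eq_zero.1 this).resolve_right hq
  exact ⟨by linarith, by linarith, by linarith⟩

theorem mem_center_iff' {X : SL(2, ℤ)} :
    X ∈ Subgroup.center SL(2, ℤ) ↔ X 0 1 = 0 ∧ X 1 0 = 0 ∧ X 0 0 = X 1 1 := by
  rw [Subgroup.mem_center_iff]
  constructor
  · intro h
    have h1 := commute_iff.1 (h ⟨!![1, 1; 0, 1], by simp⟩)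
    have h2 := commute_iff.1 (h ⟨!![1, 0; 1, 1], by simp⟩)
    simp at h1 h2
    exact ⟨h2.1.symm, h1.1, by linarith⟩
  · rintro ⟨h1, h2, h3⟩ g
    exact commute_iff.2 ⟨by rw [h1, h2]; ring, by rw [h1, h3]; ring, by rw [h2, h3]; ring⟩

theorem mem_center_iff_eq {X : SL(2, ℤ)} :
    X ∈ Subgroup.center SL(2, ℤ) ↔ X = 1 ∨ X = -1 := by
  rw [mem_center_iff']
  constructor
  · rintro ⟨h1, h2, h3⟩
    have := det_eq X
    rw [h1, h3] at this
    have h4 : X 1 1 ^ 2 = 1 := by linarith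
    rcases mul_self_eq_one_iff.1 ((sq _).symm.trans h4) with h | h
    · left; rw [ext_iff4]; simp [h1, h2, h3, h]
    · right; rw [ext_iff4]; simp [h1, h2, h3, h]
  · rintro (rfl | rfl) <;> simp

/-- Matrices commute exactly when their traceless parts are proportional. The traceless part of Y is
non-zero, so those of X and Z are multiples of it; `key` multiplies by a coordinate of Y, one of
which can be cancelled. -/
theorem commute_of_commute_of_notMem_center {X Y Z : SL(2, ℤ)}
    (hY : Y ∉ Subgroup.center SL(2, ℤ)) (h1 : Commute X Y) (h2 : Commute Y Z) : Commute X Z := by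
  rw [mem_center_iff'] at hY
  rw [commute_iff] at *
  obtain ⟨a1, a2, a3⟩ := h1
  obtain ⟨b1, b2, b3⟩ := h2
  have key : ∀ t, t = Y 0 1 ∨ t = Y 1 0 ∨ t = Y 0 0 - Y 1 1 →
      t * (X 0 1 * Z 1 0 - X 1 0 * Z 0 1) = 0 ∧
      t * (X 0 1 * (Z 0 0 - Z 1 1) - Z 0 1 * (X 0 0 - X 1 1)) = 0 ∧
      t * (X 1 0 * (Z 0 0 - Z 1 1) - Z 1 0 * (X 0 0 - X 1 1)) = 0 := by
    rintro t (rfl | rfl | rfl)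
    · refine ⟨?_, ?_, ?_⟩
      · linear_combination X 0 1 * b1 + Z 0 1 * a1
      · linear_combination X 0 1 * b2 + Z 0 1 * a2
      · linear_combination X 1 0 * b2 + Z 0 1 * a3 - (X 0 0 - X 1 1) * b1
    · refine ⟨?_, ?_, ?_⟩
      · linear_combination Z 1 0 * a1 + X 1 0 * b1
      · linear_combination X 0 1 * b3 + Z 1 0 * a2 + (X 0 0 - X 1 1) * b1
      · linear_combination X 1 0 * b3 + Z 1 0 * a3
    · refine ⟨?_, ?_, ?_⟩
      · linear_combination Z 1 0 * a2 + (X 0 0 - X 1 1) * b1 - Z 0 1 * a3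
      · linear_combination (Z 0 0 - Z 1 1) * a2 + (X 0 0 - X 1 1) * b2
      · linear_combination (Z 0 0 - Z 1 1) * a3 + (X 0 0 - X 1 1) * b3
  have : ∃ t, t ≠ 0 ∧ (t = Y 0 1 ∨ t = Y 1 0 ∨ t = Y 0 0 - Y 1 1) := by
    by_contra hcon
    push Not at hcon
    apply hY
    refine ⟨?_, ?_, ?_⟩
    · by_contra h0; exact (hcon _ h0).1 rfl
    · by_contra h0; exact (hcon _ h0).2.1 rfl
    · by_contra h0; exact (hcon _ (sub_ne_zero.2 h0)).2.2 rfl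
  obtain ⟨t, h0, ht⟩ := this
  obtain ⟨k1, k2, k3⟩ := key t ht
  simp only [mul_eq_zero, h0, false_or] at k1 k2 k3
  exact ⟨by linarith, by linarith, by linarith⟩

theorem tr_neg (X : SL(2, ℤ)) : tr (-X) = -tr X := by
  simp only [tr, neg_apply]; ring

theorem tr_mul_comm (X Y : SL(2, ℤ)) : tr (X * Y) = tr (Y * X) := by
  simp only [tr, mul_00, mul_11]; ring

theorem tr_inv (X : SL(2, ℤ)) : tr X⁻¹ = tr X := by
  simp only [tr, inv_00, inv_11]; ring

theorem tr_mul_inv (X Y : SL(2, ℤ)) : tr (X * Y⁻¹) = tr X * tr Y - tr (X * Y) := by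
  simp only [tr, mul_00, mul_11, inv_00, inv_11, inv_01, inv_10]; ring

theorem tr_conj (X Y : SL(2, ℤ)) : tr (X * Y * X⁻¹) = tr Y := by
  rw [tr_mul_comm, inv_mul_cancel_left]

theorem notMem_center_of_abs_tr_le {X : SL(2, ℤ)} (h : |tr X| ≤ 1) :
    X ∉ Subgroup.center SL(2, ℤ) := by
  rw [mem_center_iff_eq]
  rintro (rfl | rfl)
  · simp [tr] at h
  · rw [tr_neg] at h; simp [tr] at h

/-- The powers of a matrix are combinations of the matrix and the identity; the coefficient of
the matrix does not vanish if the trace is at least two in absolute value. -/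
theorem exists_pow_succ_eq {X : SL(2, ℤ)} (h : 2 ≤ |tr X|) (k : ℕ) :
    ∃ p q : ℤ, |q| < |p| ∧ (X ^ (k + 1)) 0 0 = p * X 0 0 - q ∧ (X ^ (k + 1)) 0 1 = p * X 0 1 ∧
      (X ^ (k + 1)) 1 0 = p * X 1 0 ∧ (X ^ (k + 1)) 1 1 = p * X 1 1 - q := by
  induction k with
  | zero => exact ⟨1, 0, by simp, by simp, by simp, by simp, by simp⟩
  | succ k ih =>
    obtain ⟨p, q, hpq, h1, h2, h3, h4⟩ := ih
    have hd := det_eq X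
    -- Cayley–Hamilton turns (pX − q)X into (p tr X − q)X − p, and |p tr X − q| ≥ 2|p| − |q| > |p|.
    refine ⟨p * tr X - q, p, ?_, ?_, ?_, ?_, ?_⟩
    · have h5 : |p * tr X| ≤ |p * tr X - q| + |q| := by
        have := abs_add_le (p * tr X - q) q
        simpa using this
      rw [abs_mul] at h5
      nlinarith [abs_nonneg p]
    · rw [pow_succ, mul_00, h1, h2, tr]; linear_combination (-p) * hd
    · rw [pow_succ, mul_01, h1, h2, tr]; ring
    · rw [pow_succ, mul_10, h3, h4, tr]; ring
    · rw [pow_succ, mul_11, h3, h4, tr]; linear_combination (-p) * hd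

theorem mem_center_of_pow_mem_center {X : SL(2, ℤ)} (h : 2 ≤ |tr X|) {k : ℕ} (hk : 0 < k)
    (hX : X ^ k ∈ Subgroup.center SL(2, ℤ)) : X ∈ Subgroup.center SL(2, ℤ) := by
  obtain ⟨k, rfl⟩ := Nat.exists_eq_add_of_lt hk
  rw [zero_add] at hX
  obtain ⟨p, q, hpq, h1, h2, h3, h4⟩ := exists_pow_succ_eq h k
  have hp : p ≠ 0 := by
    rintro rfl
    simp only [abs_zero] at hpq
    exact absurd (abs_nonneg q) (not_le.2 hpq)
  rw [mem_center_iff', h1, h2, h3, h4] at hX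
  obtain ⟨a1, a2, a3⟩ := hX
  rw [mem_center_iff']
  refine ⟨(mul_eq_zero.1 a1).resolve_left hp, (mul_eq_zero.1 a2).resolve_left hp,
    mul_left_cancel₀ hp (by linarith)⟩

theorem sq_mem_center_iff {X : SL(2, ℤ)} (hX : X ∉ Subgroup.center SL(2, ℤ)) :
    X ^ 2 ∈ Subgroup.center SL(2, ℤ) ↔ tr X = 0 := by
  have hd := det_eq X
  rw [mem_center_iff'] at *
  rw [sq, mul_00, mul_01, mul_10, mul_11]
  constructor
  · rintro ⟨h1, h2, h3⟩
    by_contra h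
    apply hX
    refine ⟨?_, ?_, ?_⟩
    · apply (mul_eq_zero.1 (_ : X 0 1 * tr X = 0)).resolve_right h
      rw [tr]; linarith
    · apply (mul_eq_zero.1 (_ : X 1 0 * tr X = 0)).resolve_right h
      rw [tr]; linarith
    · apply sub_eq_zero.1
      apply (mul_eq_zero.1 (_ : _ * tr X = 0)).resolve_right h
      rw [tr]; linarith
  · intro h
    rw [tr] at h
    have : X 0 0 = -X 1 1 := by linarith
    rw [this]
    refine ⟨by ring, by ring, by ring⟩

/-- By Cayley–Hamilton the traceless part of X³ is that of X times (tr X)² − 1. -/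
theorem cube_mem_center_iff {X : SL(2, ℤ)} (hX : X ∉ Subgroup.center SL(2, ℤ)) :
    X ^ 3 ∈ Subgroup.center SL(2, ℤ) ↔ |tr X| = 1 := by
  have hd := det_eq X
  have e1 : (X ^ 3) 0 1 = X 0 1 * (tr X ^ 2 - 1) := by
    rw [pow_succ, sq, mul_01, mul_00, mul_01, tr]; linear_combination (-X 0 1) * hd
  have e2 : (X ^ 3) 1 0 = X 1 0 * (tr X ^ 2 - 1) := by
    rw [pow_succ, sq, mul_10, mul_10, mul_11, tr]; linear_combination (-X 1 0) * hd
  have e3 : (X ^ 3) 0 0 - (X ^ 3) 1 1 = (X 0 0 - X 1 1) * (tr X ^ 2 - 1) := by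
    rw [pow_succ, sq, mul_00, mul_11, mul_00, mul_01, mul_10, mul_11, tr]
    linear_combination (-(X 0 0 - X 1 1)) * hd
  rw [mem_center_iff'] at *
  rw [e1, e2, ← sub_eq_zero (a := (X ^ 3) 0 0), e3]
  have h4 : |tr X| = 1 ↔ tr X ^ 2 - 1 = 0 := by
    rw [sub_eq_zero, sq, mul_self_eq_one_iff, abs_eq zero_le_one]
  rw [h4]
  constructor
  · rintro ⟨h1, h2, h3⟩
    by_contra h
    exact hX ⟨(mul_eq_zero.1 h1).resolve_right h, (mul_eq_zero.1 h2).resolve_right h,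
      sub_eq_zero.1 ((mul_eq_zero.1 h3).resolve_right h)⟩
  · intro h
    simp [h]

/-- A matrix of trace `±2` commuting with an elliptic matrix is central. -/
theorem mem_center_of_commute {D Y : SL(2, ℤ)} (hD : |tr D| = 2) (hY : |tr Y| ≤ 1)
    (h : Commute D Y) : D ∈ Subgroup.center SL(2, ℤ) := by
  obtain ⟨a1, a2, a3⟩ := commute_iff.1 h
  have hd := det_eq D
  have hy := det_eq Y
  have hdisc : (Y 0 0 - Y 1 1) ^ 2 + 4 * (Y 0 1 * Y 1 0) < 0 := by
    have : tr Y ^ 2 ≤ 1 := by rw [sq_le_one_iff_abs_le_one]; exact hY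
    rw [tr] at this
    nlinarith
  have hn : (D 0 0 - D 1 1) ^ 2 + 4 * (D 0 1 * D 1 0) = 0 := by
    have : tr D ^ 2 = 4 := by rw [← sq_abs, hD]; norm_num
    rw [tr] at this
    linarith
  -- The traceless parts are proportional and the discriminant of D is 0, so each coordinate t of
  -- the traceless part of D satisfies t² disc(Y) = 0, where disc(Y) < 0.
  have key : ∀ t : ℤ, t ^ 2 * ((Y 0 0 - Y 1 1) ^ 2 + 4 * (Y 0 1 * Y 1 0)) = 0 → t = 0 := by
    intro t ht
    have := (mul_eq_zero.1 ht).resolve_right hdisc.ne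
    exact pow_eq_zero_iff two_ne_zero |>.1 this
  rw [mem_center_iff']
  refine ⟨key _ ?_, key _ ?_, sub_eq_zero.1 (key _ ?_)⟩
  · linear_combination Y 0 1 ^ 2 * hn + (D 0 1 * (Y 0 0 - Y 1 1) + Y 0 1 * (D 0 0 - D 1 1)) * a2 +
      4 * Y 0 1 * D 0 1 * a1
  · linear_combination Y 1 0 ^ 2 * hn + (D 1 0 * (Y 0 0 - Y 1 1) + Y 1 0 * (D 0 0 - D 1 1)) * a3 -
      4 * Y 1 0 * D 1 0 * a1
  · linear_combination (Y 0 0 - Y 1 1) ^ 2 * hn -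
      4 * Y 0 1 * (D 0 0 - D 1 1) * a3 - 4 * D 1 0 * (Y 0 0 - Y 1 1) * a2

end SL2Z

/-- The modular group `PSL(2, ℤ)`. -/
abbrev ModularPSL : Type := Matrix.ProjectiveSpecialLinearGroup (Fin 2) ℤ

/-! ### Elliptic elements and commutation in PSL(2, ℤ) -/

namespace ModularPSL

open SL2Z

/-- The projection `SL(2, ℤ) → PSL(2, ℤ)`. -/
def proj : SL(2, ℤ) →* ModularPSL := QuotientGroup.mk' _

theorem proj_surjective : Function.Surjective proj := QuotientGroup.mk'_surjective _

theorem proj_eq_one_iff {X : SL(2, ℤ)} : proj X = 1 ↔ X ∈ Subgroup.center SL(2, ℤ) :=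
  QuotientGroup.eq_one_iff X

theorem proj_eq_one_iff_eq {X : SL(2, ℤ)} : proj X = 1 ↔ X = 1 ∨ X = -1 :=
  proj_eq_one_iff.trans mem_center_iff_eq

/-- A non-trivial element of order two or three. -/
def IsElliptic (x : ModularPSL) : Prop := x ≠ 1 ∧ (x ^ 2 = 1 ∨ x ^ 3 = 1)

theorem proj_sq_eq_one {X : SL(2, ℤ)} (h : proj X ≠ 1) : proj X ^ 2 = 1 ↔ tr X = 0 := by
  rw [← map_pow, proj_eq_one_iff, sq_mem_center_iff (mt proj_eq_one_iff.2 h)]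

theorem proj_cube_eq_one {X : SL(2, ℤ)} (h : proj X ≠ 1) : proj X ^ 3 = 1 ↔ |tr X| = 1 := by
  rw [← map_pow, proj_eq_one_iff, cube_mem_center_iff (mt proj_eq_one_iff.2 h)]

theorem isElliptic_proj {X : SL(2, ℤ)} : IsElliptic (proj X) ↔ |tr X| ≤ 1 := by
  constructor
  · rintro ⟨h, h2 | h2⟩
    · rw [(proj_sq_eq_one h).1 h2]; simp
    · exact ((proj_cube_eq_one h).1 h2).le
  · intro h
    have h1 : proj X ≠ 1 := fun h1 => notMem_center_of_abs_tr_le h (proj_eq_one_iff.1 h1)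
    refine ⟨h1, ?_⟩
    rw [proj_sq_eq_one h1, proj_cube_eq_one h1]
    rcases h.lt_or_eq with h | h
    · exact Or.inl (Int.abs_lt_one_iff.1 h)
    · exact Or.inr h

/-- The only obstruction is XY = −YX. Then X, Y and XY all have trace 0, so `kappa` is 0, against
`five_le_kappa`. -/
theorem commute_proj {X Y : SL(2, ℤ)} : Commute (proj X) (proj Y) ↔ Commute X Y := by
  refine ⟨fun h => ?_, fun h => h.map proj⟩
  by_contra hn
  have h1 : proj (X * Y * (Y * X)⁻¹) = 1 := by
    rw [map_mul, map_mul, map_inv, map_mul, h.eq, mul_inv_cancel]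
  rcases proj_eq_one_iff_eq.1 h1 with h2 | h2
  · exact hn (mul_inv_eq_one.1 h2)
  · have h3 : X * Y = -(Y * X) := by
      rw [mul_inv_eq_iff_eq_mul] at h2
      rw [h2]; simp
    have t1 : tr (X * Y) = 0 := by
      have := congrArg tr h3
      rw [tr_neg, tr_mul_comm Y X] at this
      linarith
    have t2 : tr Y = 0 := by
      have h4 : X * Y * X⁻¹ = -Y := by rw [h3]; simp
      have := tr_conj X Y
      rw [h4, tr_neg] at this
      linarith
    have t3 : tr X = 0 := by
      have h4 : Y * X * Y⁻¹ = -X := by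
        have h5 : Y * X = -(X * Y) := by rw [h3]; simp
        rw [h5]; simp
      have := tr_conj Y X
      rw [h4, tr_neg] at this
      linarith
    have := five_le_kappa (by rw [t2]; simp) hn
    rw [kappa, t1, t2, t3] at this
    norm_num at this

theorem commute_trans {x y z : ModularPSL} (hy : y ≠ 1) (h1 : Commute x y) (h2 : Commute y z) :
    Commute x z := by
  obtain ⟨X, rfl⟩ := proj_surjective x
  obtain ⟨Y, rfl⟩ := proj_surjective y
  obtain ⟨Z, rfl⟩ := proj_surjective z
  rw [commute_proj] at *
  exact commute_of_commute_of_notMem_center (mt proj_eq_one_iff.2 hy) h1 h2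

theorem eq_one_or_isElliptic_of_pow_eq_one {x : ModularPSL} {k : ℕ} (hk : 0 < k)
    (h : x ^ k = 1) : x = 1 ∨ IsElliptic x := by
  obtain ⟨X, rfl⟩ := proj_surjective x
  rw [isElliptic_proj]
  by_contra! hn
  refine hn.1 (proj_eq_one_iff.2 (mem_center_of_pow_mem_center hn.2 hk ?_))
  rwa [← proj_eq_one_iff, map_pow]

/-- For a, b, c in {−1, 0, 1} the value a² + b² + c² − abc is at most 4, while `kappa` must be at
least 5. -/
theorem not_isElliptic_mul {x y : ModularPSL} (h : ¬ Commute x y) (hx : IsElliptic x)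
    (hy : IsElliptic y) : ¬ IsElliptic (x * y) := by
  obtain ⟨X, rfl⟩ := proj_surjective x
  obtain ⟨Y, rfl⟩ := proj_surjective y
  rw [← map_mul, isElliptic_proj] at *
  rw [commute_proj] at h
  intro hxy
  have := five_le_kappa hy h
  rw [kappa] at this
  rw [abs_le] at *
  generalize tr X = a at *
  generalize tr Y = b at *
  generalize tr (X * Y) = c at *
  obtain ⟨a1, a2⟩ := hx
  obtain ⟨b1, b2⟩ := hy
  obtain ⟨c1, c2⟩ := hxy
  interval_cases a <;> interval_cases b <;> interval_cases c <;> norm_num at this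

/-- Here `kappa` is 4, which forces traces ±1 with product −1. Then YZ⁻¹ has trace ±2 and commutes
with the elliptic Z, so it is central. -/
theorem eq_and_cube_eq_one_of_isElliptic_mul {y z : ModularPSL} (h : Commute y z)
    (hy : IsElliptic y) (hz : IsElliptic z) (hyz : IsElliptic (y * z)) : y = z ∧ y ^ 3 = 1 := by
  obtain ⟨Y, rfl⟩ := proj_surjective y
  obtain ⟨Z, rfl⟩ := proj_surjective z
  have hy1 := hy.1
  rw [← map_mul, isElliptic_proj] at *
  rw [commute_proj] at h
  have h4 := kappa_eq_four h
  have key : |tr Y| = 1 ∧ |tr (Y * Z⁻¹)| = 2 := by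
    rw [tr_mul_inv]
    rw [kappa] at h4
    rw [abs_le] at *
    generalize tr Y = a at *
    generalize tr Z = b at *
    generalize tr (Y * Z) = c at *
    obtain ⟨a1, a2⟩ := hy
    obtain ⟨b1, b2⟩ := hz
    obtain ⟨c1, c2⟩ := hyz
    interval_cases a <;> interval_cases b <;> interval_cases c <;>
      first | (norm_num at h4; done) | norm_num
  refine ⟨?_, (proj_cube_eq_one hy1).2 key.1⟩
  have : proj (Y * Z⁻¹) = 1 :=
    proj_eq_one_iff.2 (mem_center_of_commute key.2 hz (h.mul_left (Commute.inv_left (.refl Z))))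
  rwa [map_mul, map_inv, mul_inv_eq_one] at this

/-- With c = tr(DH), u = tr(DH⁻¹) and (tr D)² = 1 one has (tr H)² = (c + u)², so `kappa` equals 1 +
c² + cu + u² ≤ 4. -/
theorem commute_of_isElliptic_mul_inv {d h : ModularPSL} (hd : d ^ 3 = 1)
    (h1 : IsElliptic (d * h)) (h2 : IsElliptic (d * h⁻¹)) : Commute d h := by
  by_cases hd1 : d = 1
  · rw [hd1]; exact Commute.one_left h
  obtain ⟨D, rfl⟩ := proj_surjective d
  obtain ⟨H, rfl⟩ := proj_surjective h
  rw [proj_cube_eq_one hd1] at hd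
  rw [← map_mul, isElliptic_proj] at h1
  rw [← map_inv, ← map_mul, isElliptic_proj, tr_mul_inv] at h2
  rw [commute_proj]
  by_contra hn
  have := five_le_kappa hd.le (fun h => hn h.symm)
  rw [kappa, tr_mul_comm H D] at this
  have hd2 : tr D ^ 2 = 1 := by rw [← sq_abs, hd, one_pow]
  generalize tr D = a at *
  generalize tr H = b at *
  generalize tr (D * H) = c at *
  obtain ⟨u, hu⟩ : ∃ u, u = a * b - c := ⟨_, rfl⟩
  rw [← hu] at h2
  have h5 : b ^ 2 = (c + u) ^ 2 := by
    rw [hu]; linear_combination (-b ^ 2) * hd2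
  have h6 : b * a * c = (c + u) * c := by rw [hu]; ring
  rw [h5, h6, hd2] at this
  rw [abs_le] at h1 h2
  obtain ⟨b1, b2⟩ := h1
  obtain ⟨c1, c2⟩ := h2
  nlinarith [mul_nonneg (sub_nonneg.2 b1) (sub_nonneg.2 b2),
    mul_nonneg (sub_nonneg.2 c1) (sub_nonneg.2 c2), sq_nonneg (c - u)]

/-- The quotient of Z by its conjugate WZW⁻¹ is a commutator, of trace `kappa Z W` − 2. Putting this
into `kappa` = 4 for the commuting pair gives an equation that factors, and either factor forces
`kappa Z W` = 4. -/
theorem commute_of_cube_eq_one {z w : ModularPSL} (hw : w ^ 3 = 1) (hzw : (z * w) ^ 3 = 1)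
    (h : Commute z (w * z * w⁻¹)) : Commute z w := by
  by_cases hw1 : w = 1
  · rw [hw1]; exact Commute.one_right z
  by_cases hzw1 : z * w = 1
  · rw [eq_inv_of_mul_eq_one_left hzw1]; exact (Commute.refl w).inv_left
  obtain ⟨Z, rfl⟩ := proj_surjective z
  obtain ⟨W, rfl⟩ := proj_surjective w
  rw [proj_cube_eq_one hw1] at hw
  rw [← map_mul] at hzw hzw1
  rw [proj_cube_eq_one hzw1] at hzw
  rw [← map_mul, ← map_inv, ← map_mul, commute_proj] at h
  rw [commute_proj]
  by_contra hn
  have h5 := five_le_kappa hw.le hn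
  have h4 := kappa_eq_four (h.inv_right)
  have e1 : tr (Z * (W * Z * W⁻¹)⁻¹) = kappa Z W - 2 := by
    have hZ := det_eq Z
    have hW := det_eq W
    have e2 : Z * (W * Z * W⁻¹)⁻¹ = Z * W * (W * Z)⁻¹ := by group
    have e3 : tr (Z * W * (W * Z)) =
        tr Z * tr W * tr (Z * W) - tr W ^ 2 - tr Z ^ 2 + 2 := by
      simp only [tr, mul_00, mul_11, mul_01, mul_10]
      linear_combination (2 * (W 0 0 * W 1 1 - W 0 1 * W 1 0) - (W 0 0 + W 1 1) ^ 2) * hZ +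
        (2 - (Z 0 0 + Z 1 1) ^ 2) * hW
    rw [e2, tr_mul_inv, e3, tr_mul_comm W Z, kappa]
    ring
  have hw2 : tr W ^ 2 = 1 := by rw [← sq_abs, hw, one_pow]
  have hz2 : tr (Z * W) ^ 2 = 1 := by rw [← sq_abs, hzw, one_pow]
  rw [kappa, e1, tr_inv, tr_conj] at h4
  have e4 : kappa Z W = tr Z ^ 2 + 2 - tr Z * (tr W * tr (Z * W)) := by
    rw [kappa, hw2, hz2]; ring
  have hm : (tr W * tr (Z * W)) ^ 2 = 1 := by rw [mul_pow, hw2, hz2, one_mul]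
  rw [e4] at h4 h5
  generalize tr W * tr (Z * W) = m at *
  generalize tr Z = t at *
  have h6 : (t ^ 2 - t * m - 2) * (t * m - 2) = 0 := by linear_combination -h4
  rcases mul_eq_zero.1 h6 with h6 | h6
  · linarith
  · have : t ^ 2 = 4 := by
      have h7 : t * m = 2 := by linarith
      have : (t * m) ^ 2 = 4 := by rw [h7]; norm_num
      rwa [mul_pow, hm, mul_one] at this
    linarith

end ModularPSL

/-! ### The braid group on three strands as a central extension of PSL(2, ℤ) -/

namespace BraidGroup

theorem σ_mul_σ_mul_σ (n : ℕ) (i j : Fin (n - 1)) (h : (i : ℕ) + 1 = j) :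
    σ n i * σ n j * σ n i = σ n j * σ n i * σ n j := by
  have : (PresentedGroup.mk (braidRelators n)) ((FreeGroup.of i * FreeGroup.of j * FreeGroup.of i) *
        (FreeGroup.of j * FreeGroup.of i * FreeGroup.of j)⁻¹) = 1 :=
    PresentedGroup.one_of_mem (Or.inr ⟨i, j, h, rfl⟩)
  rw [map_mul, map_inv, mul_inv_eq_one] at this
  exact this

/-- Induction principle: the generators and their inverses act from the left. -/
theorem induction_left {n : ℕ} {p : BraidGroup n → Prop} (one : p 1)
    (mul : ∀ i b, p b → p (σ n i * b)) (inv : ∀ i b, p b → p ((σ n i)⁻¹ * b)) (b : BraidGroup n) :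
    p b := by
  have hb : b ∈ Subgroup.closure (Set.range (PresentedGroup.of (rels := braidRelators n))) := by
    rw [PresentedGroup.closure_range_of]; trivial
  induction hb using Subgroup.closure_induction_left with
  | one => exact one
  | mul_left x hx y _ ih => obtain ⟨i, rfl⟩ := hx; exact mul i y ih
  | inv_mul_cancel x hx y _ ih => obtain ⟨i, rfl⟩ := hx; exact inv i y ih

/-- Induction principle: the generators and their inverses act from the right. -/
theorem induction_right {n : ℕ} {p : BraidGroup n → Prop} (one : p 1)
    (mul : ∀ b i, p b → p (b * σ n i)) (inv : ∀ b i, p b → p (b * (σ n i)⁻¹)) (b : BraidGroup n) :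
    p b := by
  have hb : b ∈ Subgroup.closure (Set.range (PresentedGroup.of (rels := braidRelators n))) := by
    rw [PresentedGroup.closure_range_of]; trivial
  induction hb using Subgroup.closure_induction_right with
  | one => exact one
  | mul_right y _ x hx ih => obtain ⟨i, rfl⟩ := hx; exact mul y i ih
  | mul_inv_cancel y _ x hx ih => obtain ⟨i, rfl⟩ := hx; exact inv y i ih

theorem exponentSum_mul {n : ℕ} (a b : BraidGroup n) :
    exponentSum (a * b) = exponentSum a + exponentSum b := by
  simp [exponentSum]

theorem exponentSum_inv {n : ℕ} (a : BraidGroup n) : exponentSum a⁻¹ = -exponentSum a := by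
  simp [exponentSum]

theorem exponentSum_zpow {n : ℕ} (a : BraidGroup n) (k : ℤ) :
    exponentSum (a ^ k) = k * exponentSum a := by
  simp [exponentSum]

theorem exponentSum_σ {n : ℕ} (i : Fin (n - 1)) : exponentSum (σ n i) = 1 := by
  simp [exponentSum, exponentHom, lift_σ]

theorem exponentSum_conj {n : ℕ} (a b : BraidGroup n) :
    exponentSum (a⁻¹ * b * a) = exponentSum b := by
  rw [exponentSum_mul, exponentSum_mul, exponentSum_inv]; ring

/-- The homomorphism from the braid group on three strands given by two elements satisfying the
braid relation. -/
def liftThree {H : Type*} [Group H] (u v : H) (h : u * v * u = v * u * v) : BraidGroup 3 →* H :=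
  lift ![u, v] (by intro i j hij; have := i.2; have := j.2; omega) (by
    intro i j hij
    fin_cases i <;> fin_cases j <;> first | exact h | simp at hij)

theorem liftThree_σ_zero {H : Type*} [Group H] (u v : H) (h : u * v * u = v * u * v) :
    liftThree u v h (σ 3 0) = u := lift_σ _ _ _ _

theorem liftThree_σ_one {H : Type*} [Group H] (u v : H) (h : u * v * u = v * u * v) :
    liftThree u v h (σ 3 1) = v := lift_σ _ _ _ _

/-- The matrix of the first generator of the braid group on three strands. -/
def matA : SL(2, ℤ) := ⟨!![1, -1; 0, 1], by simp⟩

/-- The matrix of the second generator of the braid group on three strands. -/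
def matB : SL(2, ℤ) := ⟨!![1, 0; 1, 1], by simp⟩

theorem matA_apply : matA 0 0 = 1 ∧ matA 0 1 = -1 ∧ matA 1 0 = 0 ∧ matA 1 1 = 1 := by
  simp [matA]

theorem matB_apply : matB 0 0 = 1 ∧ matB 0 1 = 0 ∧ matB 1 0 = 1 ∧ matB 1 1 = 1 := by
  simp [matB]

/-- The (reduced integral Burau) representation of the braid group on three strands. -/
def toSL : BraidGroup 3 →* SL(2, ℤ) := liftThree matA matB (by decide)

theorem toSL_σ_zero : toSL (σ 3 0) = matA := liftThree_σ_zero _ _ _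
theorem toSL_σ_one : toSL (σ 3 1) = matB := liftThree_σ_one _ _ _

/-- The half twist on three strands. -/
def Δ₃ : BraidGroup 3 := σ 3 0 * σ 3 1 * σ 3 0

/-- The product of the two generators of the braid group on three strands. -/
def δ₃ : BraidGroup 3 := σ 3 0 * σ 3 1

theorem braid_three : σ 3 0 * σ 3 1 * σ 3 0 = σ 3 1 * σ 3 0 * σ 3 1 := σ_mul_σ_mul_σ 3 0 1 rfl

theorem δ₃_cube : δ₃ ^ 3 = Δ₃ ^ 2 := by
  calc δ₃ ^ 3 = σ 3 0 * σ 3 1 * σ 3 0 * (σ 3 1 * σ 3 0 * σ 3 1) := by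
        simp only [δ₃, pow_succ, pow_zero, one_mul, mul_assoc]
    _ = Δ₃ ^ 2 := by rw [← braid_three, sq, Δ₃]

theorem σ_zero_eq : σ 3 0 = δ₃⁻¹ * Δ₃ := by simp [δ₃, Δ₃, mul_assoc]

theorem σ_one_eq : σ 3 1 = Δ₃ * δ₃⁻¹ := by
  rw [Δ₃, braid_three, δ₃]; group

theorem commute_sq_Δ₃ (b : BraidGroup 3) : Commute (Δ₃ ^ 2) b := by
  have h1 : Commute (Δ₃ ^ 2) Δ₃ := (Commute.refl _).pow_left 2
  have h2 : Commute (Δ₃ ^ 2) δ₃ := by rw [← δ₃_cube]; exact (Commute.refl _).pow_left 3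
  have h : ∀ i, Commute (Δ₃ ^ 2) (σ 3 i) := by
    intro i
    fin_cases i
    · change Commute _ (σ 3 0)
      rw [σ_zero_eq]; exact h2.inv_right.mul_right h1
    · change Commute _ (σ 3 1)
      rw [σ_one_eq]; exact h1.mul_right h2.inv_right
  induction b using induction_left with
  | one => exact Commute.one_right _
  | mul i b ih => exact (h i).mul_right ih
  | inv i b ih => exact (h i).inv_right.mul_right ih

/-- The monoid of words in `σ₁⁻¹` and `σ₂`. -/
inductive IsMixedWord : BraidGroup 3 → Prop
  | one : IsMixedWord 1
  | inv_mul {w} : IsMixedWord w → IsMixedWord ((σ 3 0)⁻¹ * w)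
  | mul {w} : IsMixedWord w → IsMixedWord (σ 3 1 * w)

/-- The normal form of a braid on three strands. -/
def HasNormalForm (b : BraidGroup 3) : Prop :=
  ∃ (k : ℤ) (i : ℕ) (w : BraidGroup 3) (j : ℕ), i < 3 ∧ j < 2 ∧ IsMixedWord w ∧
    b = (Δ₃ ^ 2) ^ k * (δ₃ ^ i * w * Δ₃ ^ j)

theorem HasNormalForm.zpow_mul {b : BraidGroup 3} (h : HasNormalForm b) (m : ℤ) :
    HasNormalForm ((Δ₃ ^ 2) ^ m * b) := by
  obtain ⟨k, i, w, j, hi, hj, hw, rfl⟩ := h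
  exact ⟨m + k, i, w, j, hi, hj, hw, by rw [zpow_add]; simp only [mul_assoc]⟩

theorem HasNormalForm.δ_mul {b : BraidGroup 3} (h : HasNormalForm b) : HasNormalForm (δ₃ * b) := by
  obtain ⟨k, i, w, j, hi, hj, hw, rfl⟩ := h
  have e : δ₃ * ((Δ₃ ^ 2) ^ k * (δ₃ ^ i * w * Δ₃ ^ j)) =
      (Δ₃ ^ 2) ^ k * (δ₃ ^ (i + 1) * w * Δ₃ ^ j) := by
    rw [← mul_assoc, ← ((commute_sq_Δ₃ δ₃).zpow_left k).eq, pow_succ' δ₃ i]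
    simp only [mul_assoc]
  rw [e]
  rcases Nat.lt_or_ge (i + 1) 3 with h | h
  · exact ⟨k, i + 1, w, j, h, hj, hw, rfl⟩
  · obtain rfl : i = 2 := by omega
    refine ⟨k + 1, 0, w, j, by omega, hj, hw, ?_⟩
    rw [zpow_add, zpow_one, show 2 + 1 = 3 from rfl, δ₃_cube, pow_zero, one_mul]
    simp only [mul_assoc]

/-- The relations δ = Δσ₁⁻¹ and δ² = Δσ₂ trade a power of δ for a leading letter of the word, and
conversely, up to the central Δ². -/
theorem HasNormalForm.Δ_mul {b : BraidGroup 3} (h : HasNormalForm b) : HasNormalForm (Δ₃ * b) := by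
  obtain ⟨k, i, w, j, hi, hj, hw, rfl⟩ := h
  have e : Δ₃ * ((Δ₃ ^ 2) ^ k * (δ₃ ^ i * w * Δ₃ ^ j)) =
      (Δ₃ ^ 2) ^ k * (Δ₃ * (δ₃ ^ i * w * Δ₃ ^ j)) := by
    rw [← mul_assoc, ← ((commute_sq_Δ₃ Δ₃).zpow_left k).eq, mul_assoc]
  rw [e]
  apply HasNormalForm.zpow_mul
  have h0 : δ₃ = Δ₃ * (σ 3 0)⁻¹ := by rw [σ_zero_eq]; group
  have h1 : δ₃ ^ 2 = Δ₃ * σ 3 1 := by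
    rw [σ_one_eq, ← mul_assoc, ← sq, ← δ₃_cube]; group
  interval_cases i
  · rw [pow_zero, one_mul]
    cases hw with
    | one =>
      interval_cases j
      · exact ⟨0, 0, 1, 1, by omega, by omega, .one, by group⟩
      · exact ⟨1, 0, 1, 0, by omega, by omega, .one, by group⟩
    | @inv_mul w hw =>
      refine ⟨0, 1, w, j, by omega, hj, hw, ?_⟩
      rw [pow_one, h0]; group
    | @mul w hw =>
      refine ⟨0, 2, w, j, by omega, hj, hw, ?_⟩
      rw [h1]; group
  · refine ⟨1, 0, (σ 3 0)⁻¹ * w, j, by omega, hj, hw.inv_mul, ?_⟩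
    rw [pow_one, h0, zpow_one, sq]; group
  · refine ⟨1, 0, σ 3 1 * w, j, by omega, hj, hw.mul, ?_⟩
    rw [h1, zpow_one, sq]; group

theorem hasNormalForm (b : BraidGroup 3) : HasNormalForm b := by
  have hΔ : ∀ b, HasNormalForm b → HasNormalForm (Δ₃⁻¹ * b) := by
    intro b hb
    have : Δ₃⁻¹ * b = (Δ₃ ^ 2) ^ (-1 : ℤ) * (Δ₃ * b) := by group
    rw [this]
    exact hb.Δ_mul.zpow_mul _
  have hδ : ∀ b, HasNormalForm b → HasNormalForm (δ₃⁻¹ * b) := by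
    intro b hb
    have : δ₃⁻¹ * b = (Δ₃ ^ 2) ^ (-1 : ℤ) * (δ₃ * (δ₃ * b)) := by rw [← δ₃_cube]; group
    rw [this]
    exact hb.δ_mul.δ_mul.zpow_mul _
  induction b using induction_left with
  | one => exact ⟨0, 0, 1, 0, by omega, by omega, .one, by group⟩
  | mul i b ih =>
    fin_cases i
    · change HasNormalForm (σ 3 0 * b)
      rw [σ_zero_eq, mul_assoc]; exact hδ _ ih.Δ_mul
    · change HasNormalForm (σ 3 1 * b)
      rw [σ_one_eq, mul_assoc]; exact (hδ _ ih).Δ_mul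
  | inv i b ih =>
    fin_cases i
    · change HasNormalForm ((σ 3 0)⁻¹ * b)
      rw [σ_zero_eq, mul_inv_rev, inv_inv, mul_assoc]; exact hΔ _ ih.δ_mul
    · change HasNormalForm ((σ 3 1)⁻¹ * b)
      rw [σ_one_eq, mul_inv_rev, inv_inv, mul_assoc]; exact (hΔ _ ih).δ_mul

open SL2Z

/-- Both σ₁⁻¹ and σ₂ act by elementary matrices with non-negative entries, so nothing cancels and a
non-empty word has entry sum above 2, the entry sum of the identity. -/
theorem IsMixedWord.nonneg {w : BraidGroup 3} (h : IsMixedWord w) :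
    (0 < toSL w 0 0 ∧ 0 ≤ toSL w 0 1 ∧ 0 ≤ toSL w 1 0 ∧ 0 < toSL w 1 1) ∧
      (w = 1 ∨ 2 < toSL w 0 0 + toSL w 0 1 + toSL w 1 0 + toSL w 1 1) := by
  induction h with
  | one => simp
  | @inv_mul w hw ih =>
    obtain ⟨⟨h1, h2, h3, h4⟩, -⟩ := ih
    rw [map_mul, map_inv, toSL_σ_zero]
    simp only [mul_00, mul_01, mul_10, mul_11, inv_00, inv_01, inv_10, inv_11]
    simp only [matA, Matrix.of_apply, Matrix.cons_val_zero, Matrix.cons_val_one]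
    norm_num
    refine ⟨⟨by linarith, by linarith, by linarith, by linarith⟩, Or.inr (by linarith)⟩
  | @mul w hw ih =>
    obtain ⟨⟨h1, h2, h3, h4⟩, -⟩ := ih
    rw [map_mul, toSL_σ_one]
    simp only [mul_00, mul_01, mul_10, mul_11]
    simp only [matB, Matrix.of_apply, Matrix.cons_val_zero, Matrix.cons_val_one]
    norm_num
    refine ⟨⟨by linarith, by linarith, by linarith, by linarith⟩, Or.inr (by linarith)⟩

theorem toSL_Δ₃_sq : toSL (Δ₃ ^ 2) = -1 := by
  rw [Δ₃, map_pow, map_mul, map_mul, toSL_σ_zero, toSL_σ_one]; decide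

theorem eq_zpow_of_toSL {b : BraidGroup 3} (h : toSL b = 1 ∨ toSL b = -1) :
    ∃ k : ℤ, b = (Δ₃ ^ 2) ^ k := by
  obtain ⟨k, i, w, j, hi, hj, hw, rfl⟩ := hasNormalForm b
  have h1 : toSL (δ₃ ^ i * w * Δ₃ ^ j) = 1 ∨ toSL (δ₃ ^ i * w * Δ₃ ^ j) = -1 := by
    rw [map_mul, map_zpow, toSL_Δ₃_sq] at h
    rcases Int.even_or_odd k with hk | hk
    · rwa [hk.neg_one_zpow, one_mul] at h
    · rw [hk.neg_one_zpow] at h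
      simp only [neg_mul, one_mul, neg_inj] at h
      rw [neg_eq_iff_eq_neg] at h
      exact h.symm
  obtain ⟨⟨p1, p2, p3, p4⟩, hw1⟩ := hw.nonneg
  have eD : toSL Δ₃ = matA * matB * matA := by
    rw [Δ₃, map_mul, map_mul, toSL_σ_zero, toSL_σ_one]
  have ed : toSL δ₃ = matA * matB := by
    rw [δ₃, map_mul, toSL_σ_zero, toSL_σ_one]
  rw [map_mul, map_mul, map_pow, map_pow, eD, ed] at h1
  obtain ⟨a1, a2, a3, a4⟩ := matA_apply
  obtain ⟨b1, b2, b3, b4⟩ := matB_apply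
  -- The signs of the entries rule out every pair (i, j) except (0, 0), where the entry sum forces
  -- the empty word.
  have hmain : i = 0 ∧ j = 0 ∧ w = 1 := by
    interval_cases i <;> interval_cases j <;>
      simp only [pow_succ, pow_zero, one_mul, mul_one, ext_iff4, mul_00, mul_01, mul_10, mul_11,
        SL2Z.neg_apply, one_00, one_01, one_10, one_11, a1, a2, a3, a4, b1, b2, b3, b4] at h1
    · refine ⟨rfl, rfl, ?_⟩
      rcases hw1 with hw1 | hw1
      · exact hw1
      · rcases h1 with h1 | h1 <;> linarith
    all_goals rcases h1 with h1 | h1 <;> linarith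
  obtain ⟨rfl, rfl, rfl⟩ := hmain
  exact ⟨k, by simp⟩

/-- The projection of the braid group on three strands to the modular group. -/
def toPSL : BraidGroup 3 →* ModularPSL := ModularPSL.proj.comp toSL

theorem eq_zpow_of_toPSL_eq_one {b : BraidGroup 3} (h : toPSL b = 1) :
    ∃ k : ℤ, b = (Δ₃ ^ 2) ^ k :=
  eq_zpow_of_toSL (ModularPSL.proj_eq_one_iff_eq.1 h)

theorem exponentSum_Δ₃_sq_zpow (k : ℤ) : exponentSum ((Δ₃ ^ 2) ^ k) = k * 6 := by
  rw [exponentSum_zpow, sq, Δ₃]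
  simp only [exponentSum_mul, exponentSum_σ]
  norm_num

/-- The kernel consists of the powers of Δ², and the k-th power has exponent sum 6k. -/
theorem eq_of_toPSL_eq {a b : BraidGroup 3} (h : toPSL a = toPSL b)
    (he : exponentSum a = exponentSum b) : a = b := by
  obtain ⟨k, hk⟩ := eq_zpow_of_toPSL_eq_one (b := a * b⁻¹) (by
    rw [map_mul, map_inv, h, mul_inv_cancel])
  have h1 := congrArg exponentSum hk
  rw [exponentSum_Δ₃_sq_zpow, exponentSum_mul, exponentSum_inv, he] at h1
  obtain rfl : k = 0 := by omega
  rwa [zpow_zero, mul_inv_eq_one] at hk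

theorem commute_of_toPSL {a b : BraidGroup 3} (h : Commute (toPSL a) (toPSL b)) : Commute a b :=
  eq_of_toPSL_eq (by rw [map_mul, map_mul, h.eq]) (by
    rw [exponentSum_mul, exponentSum_mul, add_comm])

theorem commute_of_toPSL_eq_one {a : BraidGroup 3} (h : toPSL a = 1) (b : BraidGroup 3) :
    Commute a b :=
  commute_of_toPSL (by rw [h]; exact Commute.one_left _)

end BraidGroup

/-! ### The Hurwitz action, full twists and finite orbits -/

section HurwitzEquiv

variable {G : Type*} [Group G]

theorem hurwitz_one {n : ℕ} (s : Fin n → G) : hurwitz s 1 = s := by simp [hurwitz]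

theorem hurwitz_σ_inv {n : ℕ} (s : Fin n → G) (i : Fin (n - 1)) :
    hurwitz s (BraidGroup.σ n i)⁻¹ = (hurwitzMove i).symm s := by
  rw [Equiv.eq_symm_apply, ← hurwitz_σ, ← hurwitz_mul, inv_mul_cancel, hurwitz_one]

/-- Two tuples are Hurwitz equivalent if they lie in the same orbit. -/
def HurwitzEquiv {n : ℕ} (s t : Fin n → G) : Prop := ∃ b : BraidGroup n, hurwitz s b = t

namespace HurwitzEquiv

theorem refl {n : ℕ} (s : Fin n → G) : HurwitzEquiv s s := ⟨1, hurwitz_one s⟩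

theorem trans {n : ℕ} {s t u : Fin n → G} (h1 : HurwitzEquiv s t) (h2 : HurwitzEquiv t u) :
    HurwitzEquiv s u := by
  obtain ⟨b, rfl⟩ := h1
  obtain ⟨c, rfl⟩ := h2
  exact ⟨b * c, hurwitz_mul _ _ _⟩

theorem symm {n : ℕ} {s t : Fin n → G} (h : HurwitzEquiv s t) : HurwitzEquiv t s := by
  obtain ⟨b, rfl⟩ := h
  exact ⟨b⁻¹, by rw [← hurwitz_mul, mul_inv_cancel, hurwitz_one]⟩

end HurwitzEquiv

/-- A property of tuples preserved by the elementary moves and their inverses is preserved by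
the braid group. -/
theorem hurwitz_induction {n : ℕ} {p : (Fin n → G) → Prop} (h1 : ∀ i s, p s → p (hurwitzMove i s))
    (h2 : ∀ i s, p s → p ((hurwitzMove i).symm s)) {s : Fin n → G} (hs : p s)
    (b : BraidGroup n) : p (hurwitz s b) := by
  induction b using BraidGroup.induction_right with
  | one => rwa [hurwitz_one]
  | mul b i ih => rw [hurwitz_mul, hurwitz_σ]; exact h1 i _ ih
  | inv b i ih => rw [hurwitz_mul, hurwitz_σ_inv]; exact h2 i _ ih

theorem hurwitzMove_symm_apply {n : ℕ} (i : Fin (n - 1)) (s : Fin n → G) (k : Fin n) :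
    (hurwitzMove i).symm s k =
      if k = BraidGroup.lo i then
        s (BraidGroup.lo i) * s (BraidGroup.hi i) * (s (BraidGroup.lo i))⁻¹
      else if k = BraidGroup.hi i then s (BraidGroup.lo i)
      else s k := rfl

theorem hurwitz_map {H : Type*} [Group H] {n : ℕ} (f : G →* H) (s : Fin n → G)
    (b : BraidGroup n) : hurwitz (f ∘ s) b = f ∘ hurwitz s b := by
  induction b using BraidGroup.induction_right with
  | one => simp only [hurwitz_one]
  | mul b i ih =>
    rw [hurwitz_mul, hurwitz_mul, ih, hurwitz_σ, hurwitz_σ]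
    funext k
    simp only [hurwitzMove_apply, Function.comp_apply]
    split_ifs <;> simp
  | inv b i ih =>
    rw [hurwitz_mul, hurwitz_mul, ih, hurwitz_σ_inv, hurwitz_σ_inv]
    funext k
    simp only [hurwitzMove_symm_apply, Function.comp_apply]
    split_ifs <;> simp

theorem hurwitzMove_zero (a b c d : G) :
    hurwitzMove (n := 4) (0 : Fin 3) ![a, b, c, d] = ![b, b⁻¹ * a * b, c, d] := by
  funext k
  rw [hurwitzMove_apply]
  fin_cases k <;> simp [BraidGroup.lo, BraidGroup.hi, Fin.ext_iff]

theorem hurwitzMove_one (a b c d : G) :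
    hurwitzMove (n := 4) (1 : Fin 3) ![a, b, c, d] = ![a, c, c⁻¹ * b * c, d] := by
  funext k
  rw [hurwitzMove_apply]
  fin_cases k <;> simp [BraidGroup.lo, BraidGroup.hi, Fin.ext_iff]

theorem hurwitzMove_two (a b c d : G) :
    hurwitzMove (n := 4) (2 : Fin 3) ![a, b, c, d] = ![a, b, d, d⁻¹ * c * d] := by
  funext k
  rw [hurwitzMove_apply]
  fin_cases k <;> simp [BraidGroup.lo, BraidGroup.hi, Fin.ext_iff]

theorem hurwitz_σ_zero (a b c d : G) :
    hurwitz ![a, b, c, d] (BraidGroup.σ 4 0) = ![b, b⁻¹ * a * b, c, d] :=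
  (hurwitz_σ _ _).trans (hurwitzMove_zero a b c d)

theorem hurwitz_σ_one (a b c d : G) :
    hurwitz ![a, b, c, d] (BraidGroup.σ 4 1) = ![a, c, c⁻¹ * b * c, d] :=
  (hurwitz_σ _ _).trans (hurwitzMove_one a b c d)

theorem hurwitz_σ_two (a b c d : G) :
    hurwitz ![a, b, c, d] (BraidGroup.σ 4 2) = ![a, b, d, d⁻¹ * c * d] :=
  (hurwitz_σ _ _).trans (hurwitzMove_two a b c d)

namespace HurwitzEquiv

theorem move_zero (a b c d : G) : HurwitzEquiv ![a, b, c, d] ![b, b⁻¹ * a * b, c, d] :=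
  ⟨_, hurwitz_σ_zero a b c d⟩

theorem move_one (a b c d : G) : HurwitzEquiv ![a, b, c, d] ![a, c, c⁻¹ * b * c, d] :=
  ⟨_, hurwitz_σ_one a b c d⟩

theorem move_two (a b c d : G) : HurwitzEquiv ![a, b, c, d] ![a, b, d, d⁻¹ * c * d] :=
  ⟨_, hurwitz_σ_two a b c d⟩

theorem move_zero_inv (a b c d : G) : HurwitzEquiv ![a, b, c, d] ![a * b * a⁻¹, a, c, d] := by
  have := (move_zero (a * b * a⁻¹) a c d).symm
  rwa [show a⁻¹ * (a * b * a⁻¹) * a = b by group] at this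

theorem rotate (a b c d : G) :
    HurwitzEquiv ![a, b, c, d] ![d, d⁻¹ * a * d, d⁻¹ * b * d, d⁻¹ * c * d] :=
  ((move_two a b c d).trans (move_one a b d _)).trans (move_zero a d _ _)

theorem rotate_inv (a b c d : G) :
    HurwitzEquiv ![a, b, c, d] ![b, c, d, d⁻¹ * (c⁻¹ * (b⁻¹ * a * b) * c) * d] :=
  ((move_zero a b c d).trans (move_one b _ c d)).trans (move_two b c _ d)

end HurwitzEquiv

/-- A tuple with finite Hurwitz orbit. -/
def HasFiniteOrbit {n : ℕ} (s : Fin n → G) : Prop := (Set.range (hurwitz s)).Finite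

theorem HasFiniteOrbit.of_equiv {n : ℕ} {s t : Fin n → G} (hs : HasFiniteOrbit s)
    (h : HurwitzEquiv s t) : HasFiniteOrbit t := by
  obtain ⟨b, rfl⟩ := h
  refine Set.Finite.subset hs ?_
  rintro _ ⟨c, rfl⟩
  exact ⟨b * c, hurwitz_mul _ _ _⟩

/-- If the powers of a braid act on some entries of a tuple with finite orbit by conjugation with
the powers of `g`, then a power of `g` commutes with these entries. -/
theorem HasFiniteOrbit.exists_pow_commute {n : ℕ} {s : Fin n → G} (hs : HasFiniteOrbit s)
    (b : BraidGroup n) (g : G) (I : Set (Fin n))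
    (h : ∀ k : ℕ, ∀ i ∈ I, hurwitz s (b ^ k) i = (g ^ k)⁻¹ * s i * g ^ k) :
    ∃ k : ℕ, 0 < k ∧ ∀ i ∈ I, Commute (g ^ k) (s i) := by
  have : ¬ Function.Injective fun k : ℕ => hurwitz s (b ^ k) := by
    intro hinj
    exact Set.infinite_range_of_injective hinj
      (hs.subset (by rintro _ ⟨k, rfl⟩; exact ⟨_, rfl⟩))
  have key : ∀ k l : ℕ, k < l → hurwitz s (b ^ k) = hurwitz s (b ^ l) →
      ∃ k : ℕ, 0 < k ∧ ∀ i ∈ I, Commute (g ^ k) (s i) := by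
    intro k l hkl he
    obtain ⟨m, rfl⟩ := Nat.exists_eq_add_of_lt hkl
    refine ⟨m + 1, by omega, fun i hi => ?_⟩
    have h1 := congrFun he i
    rw [h k i hi, h _ i hi, show k + m + 1 = (m + 1) + k by omega, pow_add, mul_inv_rev] at h1
    have h2 : s i = (g ^ (m + 1))⁻¹ * s i * g ^ (m + 1) := by
      have h3 : (g ^ k)⁻¹ * s i * g ^ k =
          (g ^ k)⁻¹ * ((g ^ (m + 1))⁻¹ * s i * g ^ (m + 1)) * g ^ k := by
        rw [h1]; simp only [mul_assoc]
      exact mul_left_cancel (mul_right_cancel h3)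
    rw [commute_iff_eq]
    nth_rewrite 1 [h2]
    group
  unfold Function.Injective at this
  push Not at this
  obtain ⟨k, l, he, hne⟩ := this
  rcases lt_or_gt_of_ne hne with h1 | h1
  · exact key k l h1 he
  · exact key l k h1 he.symm

theorem conj_pow_succ (g a : G) (k : ℕ) :
    g⁻¹ * ((g ^ k)⁻¹ * a * g ^ k) * g = (g ^ (k + 1))⁻¹ * a * g ^ (k + 1) := by
  rw [pow_succ]; group

/-- The full twist conjugates the entries it involves by their product and leaves this product
unchanged, so its powers conjugate by powers of the same element. -/
theorem hurwitz_twist_two (a b c d : G) (k : ℕ) :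
    hurwitz ![a, b, c, d] ((BraidGroup.σ 4 0 * BraidGroup.σ 4 0) ^ k) =
      ![((a * b) ^ k)⁻¹ * a * (a * b) ^ k, ((a * b) ^ k)⁻¹ * b * (a * b) ^ k, c, d] := by
  have h1 : ∀ a b : G, hurwitz ![a, b, c, d] (BraidGroup.σ 4 0 * BraidGroup.σ 4 0) =
      ![(a * b)⁻¹ * a * (a * b), (a * b)⁻¹ * b * (a * b), c, d] := by
    intro a b
    rw [hurwitz_mul, hurwitz_σ_zero, hurwitz_σ_zero]
    congr 1
    · group
    · congr 1; group
  induction k with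
  | zero => simp [hurwitz_one]
  | succ k ih =>
    have h2 : ((a * b) ^ k)⁻¹ * a * (a * b) ^ k * (((a * b) ^ k)⁻¹ * b * (a * b) ^ k) = a * b := by
      have : Commute (a * b) ((a * b) ^ k) := (Commute.refl _).pow_right k
      generalize (a * b) ^ k = x at this ⊢
      calc _ = x⁻¹ * ((a * b) * x) := by group
        _ = a * b := by rw [this.eq, inv_mul_cancel_left]
    rw [pow_succ, hurwitz_mul, ih, h1, h2, conj_pow_succ, conj_pow_succ]

theorem hurwitz_twist_three (a b c d : G) (k : ℕ) :
    hurwitz ![a, b, c, d] (((BraidGroup.σ 4 0 * BraidGroup.σ 4 1) ^ 3) ^ k) =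
      ![((a * b * c) ^ k)⁻¹ * a * (a * b * c) ^ k, ((a * b * c) ^ k)⁻¹ * b * (a * b * c) ^ k,
        ((a * b * c) ^ k)⁻¹ * c * (a * b * c) ^ k, d] := by
  have h1 : ∀ a b c : G, hurwitz ![a, b, c, d] ((BraidGroup.σ 4 0 * BraidGroup.σ 4 1) ^ 3) =
      ![(a * b * c)⁻¹ * a * (a * b * c), (a * b * c)⁻¹ * b * (a * b * c),
        (a * b * c)⁻¹ * c * (a * b * c), d] := by
    intro a b c
    simp only [pow_succ, pow_zero, one_mul, hurwitz_mul, hurwitz_σ_zero, hurwitz_σ_one]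
    congr 1
    · group
    · congr 1
      · group
      · congr 1; group
  induction k with
  | zero => simp [hurwitz_one]
  | succ k ih =>
    have h2 : ((a * b * c) ^ k)⁻¹ * a * (a * b * c) ^ k * (((a * b * c) ^ k)⁻¹ * b *
        (a * b * c) ^ k) * (((a * b * c) ^ k)⁻¹ * c * (a * b * c) ^ k) = a * b * c := by
      have : Commute (a * b * c) ((a * b * c) ^ k) := (Commute.refl _).pow_right k
      generalize (a * b * c) ^ k = x at this ⊢
      calc _ = x⁻¹ * ((a * b * c) * x) := by group
        _ = a * b * c := by rw [this.eq, inv_mul_cancel_left]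
    rw [pow_succ, hurwitz_mul, ih, h1, h2, conj_pow_succ, conj_pow_succ, conj_pow_succ]

theorem hurwitz_twist_four (a b c d : G) (k : ℕ) :
    hurwitz ![a, b, c, d]
        (((BraidGroup.σ 4 0 * BraidGroup.σ 4 1 * BraidGroup.σ 4 2) ^ 4) ^ k) =
      ![((a * b * c * d) ^ k)⁻¹ * a * (a * b * c * d) ^ k,
        ((a * b * c * d) ^ k)⁻¹ * b * (a * b * c * d) ^ k,
        ((a * b * c * d) ^ k)⁻¹ * c * (a * b * c * d) ^ k,
        ((a * b * c * d) ^ k)⁻¹ * d * (a * b * c * d) ^ k] := by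
  have h1 : ∀ a b c d : G,
      hurwitz ![a, b, c, d] ((BraidGroup.σ 4 0 * BraidGroup.σ 4 1 * BraidGroup.σ 4 2) ^ 4) =
      ![(a * b * c * d)⁻¹ * a * (a * b * c * d), (a * b * c * d)⁻¹ * b * (a * b * c * d),
        (a * b * c * d)⁻¹ * c * (a * b * c * d), (a * b * c * d)⁻¹ * d * (a * b * c * d)] := by
    intro a b c d
    simp only [pow_succ, pow_zero, one_mul, hurwitz_mul, hurwitz_σ_zero, hurwitz_σ_one,
      hurwitz_σ_two]
    congr 1
    · group
    · congr 1
      · group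
      · congr 1
        · group
        · congr 1; group
  induction k with
  | zero => simp [hurwitz_one]
  | succ k ih =>
    have h2 : ((a * b * c * d) ^ k)⁻¹ * a * (a * b * c * d) ^ k * (((a * b * c * d) ^ k)⁻¹ * b *
        (a * b * c * d) ^ k) * (((a * b * c * d) ^ k)⁻¹ * c * (a * b * c * d) ^ k) *
        (((a * b * c * d) ^ k)⁻¹ * d * (a * b * c * d) ^ k) = a * b * c * d := by
      have : Commute (a * b * c * d) ((a * b * c * d) ^ k) := (Commute.refl _).pow_right k
      generalize (a * b * c * d) ^ k = x at this ⊢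
      calc _ = x⁻¹ * ((a * b * c * d) * x) := by group
        _ = a * b * c * d := by rw [this.eq, inv_mul_cancel_left]
    rw [pow_succ, hurwitz_mul, ih, h1, h2, conj_pow_succ, conj_pow_succ, conj_pow_succ,
      conj_pow_succ]

theorem commute_conj_iff {a b d : G} : Commute (d⁻¹ * a * d) (d⁻¹ * b * d) ↔ Commute a b := by
  have := Commute.conj_iff (a := a) (b := b) d⁻¹
  rwa [inv_inv] at this

theorem commute_conj_self_iff {a d : G} : Commute d (d⁻¹ * a * d) ↔ Commute d a := by
  have := commute_conj_iff (a := d) (b := a) (d := d)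
  rwa [inv_mul_cancel, one_mul] at this

/-- All entries of a tuple commute with each other. -/
def AllCommute {n : ℕ} (s : Fin n → G) : Prop := ∀ i j, Commute (s i) (s j)

theorem AllCommute.hurwitz {n : ℕ} {s : Fin n → G} (hs : AllCommute s) (b : BraidGroup n) :
    AllCommute (hurwitz s b) := by
  apply hurwitz_induction (p := AllCommute) _ _ hs
  · intro i s hs
    have : ∀ k, ∃ j, hurwitzMove i s k = s j := by
      intro k
      rw [hurwitzMove_apply]
      split_ifs
      · exact ⟨_, rfl⟩
      · exact ⟨_, by rw [mul_assoc, (hs _ _).eq, inv_mul_cancel_left]⟩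
      · exact ⟨_, rfl⟩
    intro k l
    obtain ⟨k', hk⟩ := this k
    obtain ⟨l', hl⟩ := this l
    rw [hk, hl]; exact hs _ _
  · intro i s hs
    have : ∀ k, ∃ j, (hurwitzMove i).symm s k = s j := by
      intro k
      rw [hurwitzMove_symm_apply]
      split_ifs
      · exact ⟨_, by rw [(hs _ _).eq, mul_inv_cancel_right]⟩
      · exact ⟨_, rfl⟩
      · exact ⟨_, rfl⟩
    intro k l
    obtain ⟨k', hk⟩ := this k
    obtain ⟨l', hl⟩ := this l
    rw [hk, hl]; exact hs _ _

theorem hurwitz_ne_one {n : ℕ} {s : Fin n → G} (hs : ∀ i, s i ≠ 1) (b : BraidGroup n) :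
    ∀ i, hurwitz s b i ≠ 1 := by
  apply hurwitz_induction (p := fun s : Fin n → G => ∀ i, s i ≠ 1) _ _ hs
  · intro i s hs k
    rw [hurwitzMove_apply]
    split_ifs
    · exact hs _
    · intro h
      apply hs (BraidGroup.lo i)
      rw [mul_assoc, inv_mul_eq_one] at h
      exact mul_eq_right.1 h.symm
    · exact hs _
  · intro i s hs k
    rw [hurwitzMove_symm_apply]
    split_ifs
    · intro h
      rw [conj_eq_one_iff] at h
      exact hs _ h
    · exact hs _
    · exact hs _

end HurwitzEquiv

/-! ### Classification of finite irreducible orbits in PSL(2, ℤ) -/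

namespace ModularPSL

theorem IsElliptic.inv {x : ModularPSL} (h : IsElliptic x) : IsElliptic x⁻¹ := by
  refine ⟨inv_ne_one.2 h.1, ?_⟩
  rw [inv_pow, inv_pow, inv_eq_one, inv_eq_one]
  exact h.2

theorem isElliptic_conj {x g : ModularPSL} : IsElliptic (g⁻¹ * x * g) ↔ IsElliptic x := by
  have h : ∀ n, (g⁻¹ * x * g) ^ n = g⁻¹ * x ^ n * g := by
    intro n
    have := conj_pow (i := n) (a := g⁻¹) (b := x)
    rwa [inv_inv] at this
  have h2 : ∀ y, g⁻¹ * y * g = 1 ↔ y = 1 := by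
    intro y
    have := conj_eq_one_iff (a := g⁻¹) (b := y)
    rwa [inv_inv] at this
  rw [IsElliptic, IsElliptic, h, h, h2, h2, Ne, h2]

theorem isElliptic_mul_comm {x y : ModularPSL} : IsElliptic (x * y) ↔ IsElliptic (y * x) := by
  rw [← isElliptic_conj (x := x * y) (g := x), mul_assoc, mul_assoc, inv_mul_cancel_left]

/-- A tuple in the modular group with finite Hurwitz orbit, without trivial entries, whose entries
do not all commute. -/
structure IsFiniteIrreducible {n : ℕ} (s : Fin n → ModularPSL) : Prop where
  finite : HasFiniteOrbit s
  ne_one : ∀ i, s i ≠ 1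
  not_comm : ¬ AllCommute s

namespace IsFiniteIrreducible

theorem of_equiv {n : ℕ} {s t : Fin n → ModularPSL} (hs : IsFiniteIrreducible s)
    (h : HurwitzEquiv s t) : IsFiniteIrreducible t := by
  refine ⟨hs.finite.of_equiv h, ?_, ?_⟩
  · obtain ⟨b, rfl⟩ := h
    exact hurwitz_ne_one hs.ne_one b
  · intro ht
    obtain ⟨b, rfl⟩ := h.symm
    exact hs.not_comm (ht.hurwitz b)

variable {a b c d : ModularPSL}

theorem ne_one_zero (h : IsFiniteIrreducible ![a, b, c, d]) : a ≠ 1 := h.ne_one 0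
theorem ne_one_one (h : IsFiniteIrreducible ![a, b, c, d]) : b ≠ 1 := h.ne_one 1
theorem ne_one_two (h : IsFiniteIrreducible ![a, b, c, d]) : c ≠ 1 := h.ne_one 2
theorem ne_one_three (h : IsFiniteIrreducible ![a, b, c, d]) : d ≠ 1 := h.ne_one 3

theorem not_commute_of_commute (h : IsFiniteIrreducible ![a, b, c, d]) (hab : Commute a b)
    (hbc : Commute b c) : ¬ Commute c d := by
  intro hcd
  apply h.not_comm
  have hac := commute_trans h.ne_one_one hab hbc
  have had := commute_trans h.ne_one_two hac hcd
  have hbd := commute_trans h.ne_one_two hbc hcd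
  intro i j
  fin_cases i <;> fin_cases j <;>
    first | exact Commute.refl _ | assumption | (apply Commute.symm; assumption)

/-- Some power of ab commutes with a and b. Were it non-trivial, a and b would commute by
`commute_trans`; so ab is torsion. -/
theorem isElliptic_mul (h : IsFiniteIrreducible ![a, b, c, d]) (hab : ¬ Commute a b) :
    IsElliptic (a * b) := by
  obtain ⟨k, hk, hc⟩ := h.finite.exists_pow_commute
    (BraidGroup.σ 4 0 * BraidGroup.σ 4 0) (a * b) {0, 1} (by
      intro k i hi
      rw [hurwitz_twist_two]
      rcases hi with rfl | rfl <;> rfl)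
  have h0 : Commute ((a * b) ^ k) a := hc 0 (Or.inl rfl)
  have h1 : Commute ((a * b) ^ k) b := hc 1 (Or.inr rfl)
  have h2 : (a * b) ^ k = 1 := by
    by_contra h2
    exact hab (commute_trans h2 h0.symm h1)
  refine (eq_one_or_isElliptic_of_pow_eq_one hk h2).resolve_left fun h3 => hab ?_
  rw [eq_inv_of_mul_eq_one_left h3]
  exact (Commute.refl b).inv_left

theorem isElliptic_mul' (h : IsFiniteIrreducible ![a, b, c, d]) (hcd : ¬ Commute c d) :
    IsElliptic (c * d) := by
  have h1 := h.of_equiv ((HurwitzEquiv.rotate a b c d).trans (HurwitzEquiv.rotate _ _ _ _))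
  have h2 := h1.isElliptic_mul (by
    rwa [commute_conj_self_iff, Commute.symm_iff, commute_conj_self_iff, Commute.symm_iff])
  convert h2 using 1
  group

theorem eq_one_or_isElliptic_mul_mul (h : IsFiniteIrreducible ![a, b, c, d])
    (hc : ¬ (Commute a b ∧ Commute b c)) : a * b * c = 1 ∨ IsElliptic (a * b * c) := by
  obtain ⟨k, hk, hc1⟩ := h.finite.exists_pow_commute
    ((BraidGroup.σ 4 0 * BraidGroup.σ 4 1) ^ 3) (a * b * c) {0, 1, 2} (by
      intro k i hi
      rw [hurwitz_twist_three]
      rcases hi with rfl | rfl | rfl <;> rfl)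
  have h0 : Commute ((a * b * c) ^ k) a := hc1 0 (by simp)
  have h1 : Commute ((a * b * c) ^ k) b := hc1 1 (by simp)
  have h2 : Commute ((a * b * c) ^ k) c := hc1 2 (by simp)
  refine eq_one_or_isElliptic_of_pow_eq_one hk ?_
  by_contra h3
  exact hc ⟨commute_trans h3 h0.symm h1, commute_trans h3 h1.symm h2⟩

theorem eq_one_or_isElliptic_prod (h : IsFiniteIrreducible ![a, b, c, d]) :
    a * b * c * d = 1 ∨ IsElliptic (a * b * c * d) := by
  obtain ⟨k, hk, hc1⟩ := h.finite.exists_pow_commute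
    ((BraidGroup.σ 4 0 * BraidGroup.σ 4 1 * BraidGroup.σ 4 2) ^ 4) (a * b * c * d) Set.univ (by
      intro k i hi
      rw [hurwitz_twist_four]
      fin_cases i <;> rfl)
  refine eq_one_or_isElliptic_of_pow_eq_one hk ?_
  by_contra h3
  exact h.not_comm fun i j => commute_trans h3 (hc1 i trivial).symm (hc1 j trivial)

theorem isElliptic_last_of_prod_eq_one (h : IsFiniteIrreducible ![a, b, c, d])
    (h1 : a * b * c * d = 1) : IsElliptic d := by
  rw [eq_inv_of_mul_eq_one_right h1]
  apply IsElliptic.inv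
  have hd := eq_inv_of_mul_eq_one_right h1
  refine (h.eq_one_or_isElliptic_mul_mul ?_).resolve_left ?_
  · rintro ⟨hab, hbc⟩
    have hac := commute_trans h.ne_one_one hab hbc
    refine h.not_commute_of_commute hab hbc ?_
    rw [hd]
    exact ((hac.symm.mul_right hbc.symm).mul_right (Commute.refl c)).inv_right
  · intro h2
    rw [h2, one_mul] at h1
    exact h.ne_one_three h1

/-- If the product were 1, every entry would be elliptic, being inverse to a product of three.
Neighbours would then commute by `not_isElliptic_mul`, and rotating makes all entries commute. -/
theorem isElliptic_prod (h : IsFiniteIrreducible ![a, b, c, d]) :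
    IsElliptic (a * b * c * d) := by
  refine h.eq_one_or_isElliptic_prod.resolve_left fun h1 => ?_
  have key : ∀ a b c d : ModularPSL, IsFiniteIrreducible ![a, b, c, d] → a * b * c * d = 1 →
      IsElliptic c ∧ IsElliptic d := by
    intro a b c d h h1
    refine ⟨?_, h.isElliptic_last_of_prod_eq_one h1⟩
    have := (h.of_equiv (HurwitzEquiv.rotate a b c d)).isElliptic_last_of_prod_eq_one (by
      rw [← h1]; group)
    rwa [isElliptic_conj] at this
  have hcd : ∀ a b c d : ModularPSL, IsFiniteIrreducible ![a, b, c, d] → a * b * c * d = 1 →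
      Commute c d := by
    intro a b c d h h1
    by_contra hn
    obtain ⟨h2, h3⟩ := key a b c d h h1
    exact not_isElliptic_mul hn h2 h3 (h.isElliptic_mul' hn)
  have hp : ∀ a b c d : ModularPSL, a * b * c * d = 1 →
      d * (d⁻¹ * a * d) * (d⁻¹ * b * d) * (d⁻¹ * c * d) = 1 := by
    intro a b c d h
    rw [← h]; group
  have h2 := h.of_equiv (HurwitzEquiv.rotate a b c d)
  have e2 := hp _ _ _ _ h1
  have h3 := h2.of_equiv (HurwitzEquiv.rotate _ _ _ _)
  have e3 := hp _ _ _ _ e2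
  have c1 := hcd _ _ _ _ h h1
  have c2 := hcd _ _ _ _ h2 e2
  have c3 := hcd _ _ _ _ h3 e3
  rw [commute_conj_iff] at c2
  rw [commute_conj_iff, commute_conj_iff] at c3
  exact h.not_commute_of_commute c3 c2 c1

/-- The elements ab, cd and their product are all elliptic, so ab and cd must commute and hence
coincide with order three. -/
theorem eq_of_not_commute (h : IsFiniteIrreducible ![a, b, c, d]) (hab : ¬ Commute a b)
    (hcd : ¬ Commute c d) : a * b = c * d ∧ (a * b) ^ 3 = 1 := by
  have h1 := h.isElliptic_mul hab
  have h2 := h.isElliptic_mul' hcd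
  have h3 := h.isElliptic_prod
  rw [mul_assoc] at h3
  apply eq_and_cube_eq_one_of_isElliptic_mul _ h1 h2 h3
  by_contra h4
  exact not_isElliptic_mul h4 h1 h2 h3

/-- Exchanging b and c shows that ac and bd are elliptic. Up to conjugation these are D h⁻¹ and D h
for D = ab = cd and h = bc⁻¹, so D commutes with h. If h ≠ 1, then b, which commutes with h,
commutes with ab and hence with a. -/
theorem eq_of_commute_middle (h : IsFiniteIrreducible ![a, b, c, d]) (hab : ¬ Commute a b)
    (hcd : ¬ Commute c d) (hbc : Commute b c) : b = c := by
  obtain ⟨e, e3⟩ := h.eq_of_not_commute hab hcd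
  have h1 := h.of_equiv (HurwitzEquiv.move_one a b c d)
  rw [mul_assoc c⁻¹, hbc.eq, inv_mul_cancel_left] at h1
  have hac : ¬ Commute a c := fun hn => hab (commute_trans h.ne_one_two hn hbc.symm)
  have hbd : ¬ Commute b d := fun hn => hcd (commute_trans h.ne_one_one hbc.symm hn)
  have e1 := h1.isElliptic_mul hac
  have e2 := h1.isElliptic_mul' hbd
  have hcomm : Commute (a * b) (b * c⁻¹) := by
    apply commute_of_isElliptic_mul_inv e3
    · rw [isElliptic_mul_comm, e]
      convert e2 using 1
      group
    · convert e1 using 1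
      rw [mul_inv_rev, inv_inv, mul_assoc, ← mul_assoc b, hbc.eq]
      group
  by_contra hne
  have h5 : b * c⁻¹ ≠ 1 := fun h5 => hne (mul_inv_eq_one.1 h5)
  have h6 : Commute b (b * c⁻¹) := (Commute.refl b).mul_right hbc.inv_right
  have h7 : Commute b (a * b) := commute_trans h5 h6 hcomm.symm
  apply hab
  have := h7.mul_right (Commute.refl b).inv_right
  rw [mul_inv_cancel_right] at this
  exact this.symm

theorem eq_of_commute_outer (h : IsFiniteIrreducible ![a, b, c, d]) (hab : ¬ Commute a b)
    (hcd : ¬ Commute c d) (had : Commute a d) : a = d := by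
  have h1 := h.of_equiv ((HurwitzEquiv.move_zero_inv a b c d).trans (HurwitzEquiv.move_two _ _ _ _))
  refine h1.eq_of_commute_middle ?_ ?_ had
  · intro h2
    apply hab
    rw [← Commute.conj_iff a, mul_inv_cancel_right]
    exact h2.symm
  · rw [commute_conj_self_iff]
    exact fun h2 => hcd h2.symm

/-- After a rotation the argument for ab = cd applies to ad as well. Both (ab)² and (ad)² equal
abcd, and both cubes are 1, so ab = ad. -/
theorem eq_of_not_commute_of_not_commute (h : IsFiniteIrreducible ![a, b, c, d])
    (hab : ¬ Commute a b) (hcd : ¬ Commute c d) (hbc : ¬ Commute b c) (had : ¬ Commute a d) :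
    b = d := by
  obtain ⟨e, e3⟩ := h.eq_of_not_commute hab hcd
  have h1 := h.of_equiv (HurwitzEquiv.rotate a b c d)
  obtain ⟨f, f3⟩ := h1.eq_of_not_commute (by
    rw [commute_conj_self_iff]; exact fun h2 => had h2.symm) (by rwa [commute_conj_iff])
  rw [mul_assoc, mul_inv_cancel_left] at f f3
  have h2 : (a * b) ^ 2 = (a * d) ^ 2 := by
    rw [sq, sq]
    nth_rewrite 2 [e]
    nth_rewrite 2 [f]
    group
  have h3 : a * b = a * d := by
    calc a * b = ((a * b) ^ 2) ^ 2 := by rw [← pow_mul, pow_succ, e3, one_mul]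
      _ = ((a * d) ^ 2) ^ 2 := by rw [h2]
      _ = a * d := by rw [← pow_mul, pow_succ, f3, one_mul]
  exact mul_left_cancel h3

theorem exists_equiv_alternating (h : IsFiniteIrreducible ![a, b, c, d]) (hab : ¬ Commute a b)
    (hcd : ¬ Commute c d) :
    ∃ u v, HurwitzEquiv ![a, b, c, d] ![u, v, u, v] ∧ ¬ Commute u v := by
  obtain ⟨e, e3⟩ := h.eq_of_not_commute hab hcd
  by_cases hbc : Commute b c
  · obtain rfl := h.eq_of_commute_middle hab hcd hbc
    refine ⟨b, d, ?_, hcd⟩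
    have := HurwitzEquiv.move_zero a b b d
    rwa [mul_assoc, e, inv_mul_cancel_left] at this
  · by_cases had : Commute a d
    · obtain rfl := h.eq_of_commute_outer hab hcd had
      refine ⟨c, a, ?_, hcd⟩
      have := HurwitzEquiv.move_zero_inv a b c a
      rwa [e, mul_inv_cancel_right] at this
    · obtain rfl := h.eq_of_not_commute_of_not_commute hab hcd hbc had
      obtain rfl := mul_right_cancel e
      exact ⟨a, b, HurwitzEquiv.refl _, hab⟩

/-- Twisting the last pair yields (u, v, p, q) with p = v⁻¹uv and q = p⁻¹vp. Either u = q, which is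
the braid relation, or v = q, which would make v commute with p. -/
theorem braid_of_alternating {u v : ModularPSL} (h : IsFiniteIrreducible ![u, v, u, v])
    (huv : ¬ Commute u v) : u * v * u = v * u * v := by
  have h1 := h.of_equiv ((HurwitzEquiv.move_two u v u v).trans (HurwitzEquiv.move_two _ _ _ _))
  have hvp : ¬ Commute v (v⁻¹ * u * v) := by
    rw [commute_conj_self_iff]; exact fun h2 => huv h2.symm
  have hpq : ¬ Commute (v⁻¹ * u * v) ((v⁻¹ * u * v)⁻¹ * v * (v⁻¹ * u * v)) := by
    rw [commute_conj_self_iff]; exact fun h2 => hvp h2.symm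
  by_cases huq : Commute u ((v⁻¹ * u * v)⁻¹ * v * (v⁻¹ * u * v))
  · have h2 := h1.eq_of_commute_outer huv hpq huq
    have h3 : v⁻¹ * u * v * u = u * v := by
      nth_rewrite 2 [h2]
      group
    calc u * v * u = v * (v⁻¹ * u * v * u) := by group
      _ = v * u * v := by rw [h3, mul_assoc]
  · have h2 := h1.eq_of_not_commute_of_not_commute huv hpq hvp huq
    exfalso
    apply hvp
    rw [mul_assoc (v⁻¹ * u * v)⁻¹, eq_inv_mul_iff_mul_eq] at h2
    exact h2.symm

/-- A tuple is of braid type if its orbit contains `(u, v, u, v)` with `u v u = v u v`. -/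
def _root_.ModularPSL.IsBraidType (s : Fin 4 → ModularPSL) : Prop :=
  ∃ u v, HurwitzEquiv s ![u, v, u, v] ∧ u * v * u = v * u * v

theorem isBraidType (h : IsFiniteIrreducible ![a, b, c, d]) (hab : ¬ Commute a b)
    (hcd : ¬ Commute c d) : IsBraidType ![a, b, c, d] := by
  obtain ⟨u, v, h1, h2⟩ := h.exists_equiv_alternating hab hcd
  exact ⟨u, v, h1, (h.of_equiv h1).braid_of_alternating h2⟩

theorem _root_.ModularPSL.IsBraidType.of_equiv {s t : Fin 4 → ModularPSL} (ht : IsBraidType t)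
    (h : HurwitzEquiv s t) : IsBraidType s := by
  obtain ⟨u, v, h1, h2⟩ := ht
  exact ⟨u, v, h.trans h1, h2⟩

/-- A tuple is of dihedral type if its orbit contains a tuple of three commuting elements and an
involution inverting them. -/
def _root_.ModularPSL.IsDihedralType (s : Fin 4 → ModularPSL) : Prop :=
  ∃ a b c d, HurwitzEquiv s ![a, b, c, d] ∧ Commute a b ∧ Commute a c ∧ Commute b c ∧ d ^ 2 = 1 ∧
    d⁻¹ * a * d = a⁻¹ ∧ d⁻¹ * b * d = b⁻¹ ∧ d⁻¹ * c * d = c⁻¹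

theorem _root_.ModularPSL.IsDihedralType.of_equiv {s t : Fin 4 → ModularPSL}
    (ht : IsDihedralType t) (h : HurwitzEquiv s t) : IsDihedralType s := by
  obtain ⟨a, b, c, d, h1, h2⟩ := ht
  exact ⟨a, b, c, d, h.trans h1, h2⟩

/-- Expanding (xd)² = 1 writes d² as the inverse of x · dxd⁻¹, which commutes with c. A non-trivial
d² would link c to d. -/
theorem _root_.ModularPSL.sq_eq_one_of_commute {x : ModularPSL} (hcd : ¬ Commute c d)
    (hx : Commute c x) (hx1 : Commute c (d * x * d⁻¹)) (h : (x * d) ^ 2 = 1) : d ^ 2 = 1 := by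
  by_contra h2
  refine hcd (commute_trans h2 ?_ ((Commute.refl d).pow_left 2))
  have : d ^ 2 = (x * (d * x * d⁻¹))⁻¹ := by
    rw [eq_comm, inv_eq_iff_mul_eq_one, ← h]
    simp only [sq]; group
  rw [this]
  exact (hx.mul_right hx1).inv_right

theorem _root_.ModularPSL.cube_eq_one_of_commute {x : ModularPSL} (hcd : ¬ Commute c d)
    (hx : Commute c x) (hx1 : Commute c (d * x * d⁻¹))
    (hx2 : Commute c (d * (d * x * d⁻¹) * d⁻¹)) (h : (x * d) ^ 3 = 1) : d ^ 3 = 1 := by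
  by_contra h2
  refine hcd (commute_trans h2 ?_ ((Commute.refl d).pow_left 3))
  have : d ^ 3 = (x * (d * x * d⁻¹) * (d * (d * x * d⁻¹) * d⁻¹))⁻¹ := by
    rw [eq_comm, inv_eq_iff_mul_eq_one, ← h]
    simp only [pow_succ, pow_zero]; group
  rw [this]
  exact ((hx.mul_right hx1).mul_right hx2).inv_right

theorem conj_eq_inv (h : IsFiniteIrreducible ![a, b, c, d]) (hcd : ¬ Commute c d)
    (hc : Commute c (d * c * d⁻¹)) (hc2 : Commute c (d * (d * c * d⁻¹) * d⁻¹)) (hd : d ^ 2 = 1) :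
    d⁻¹ * c * d = c⁻¹ := by
  have hdi : d⁻¹ = d := inv_eq_of_mul_eq_one_right (by rw [← sq, hd])
  rcases (h.isElliptic_mul' hcd).2 with h1 | h1
  · rw [eq_comm, inv_eq_iff_mul_eq_one, hdi, ← h1]
    simp only [sq, mul_assoc]
  · exfalso
    have := cube_eq_one_of_commute hcd (Commute.refl c) hc hc2 h1
    rw [pow_succ, hd, one_mul] at this
    exact h.ne_one_three this

theorem isBraidType_or_isDihedralType_of_commute (h : IsFiniteIrreducible ![a, b, c, d])
    (hab : Commute a b) (hbc : Commute b c) :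
    IsBraidType ![a, b, c, d] ∨ IsDihedralType ![a, b, c, d] := by
  have hac := commute_trans h.ne_one_one hab hbc
  have hcd := h.not_commute_of_commute hab hbc
  have hbd : ¬ Commute b d := fun hn => hcd (commute_trans h.ne_one_one hbc.symm hn)
  have had : ¬ Commute a d := fun hn => hcd (commute_trans h.ne_one_zero hac.symm hn)
  by_cases hc : Commute c (d⁻¹ * c * d)
  · right
    have hcd1 : Commute c (d * c * d⁻¹) := by
      have := (Commute.conj_iff d).2 hc
      rw [show d * (d⁻¹ * c * d) * d⁻¹ = c by group] at this
      exact this.symm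
    have hne : ∀ x : ModularPSL, x ≠ 1 → d * x * d⁻¹ ≠ 1 := fun x hx hn =>
      hx (conj_eq_one_iff.1 hn)
    have hX : ∀ x : ModularPSL, Commute c x → Commute c (d * x * d⁻¹) := fun x hx =>
      commute_trans (hne c h.ne_one_two) hcd1 ((Commute.conj_iff d).2 hx)
    -- If abcd has order two, so has d. If it has order three, then d³ = 1, and the elliptic cd
    -- forces either d² = 1, so d = 1, or that c and d commute.
    have hd : d ^ 2 = 1 := by
      have hP : Commute c (a * b * c) := (hac.symm.mul_right hbc.symm).mul_right (Commute.refl c)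
      rcases h.isElliptic_prod.2 with h1 | h1
      · exact sq_eq_one_of_commute hcd hP (hX _ hP) h1
      · exfalso
        have h3 := cube_eq_one_of_commute hcd hP (hX _ hP) (hX _ (hX _ hP)) h1
        rcases (h.isElliptic_mul' hcd).2 with h4 | h4
        · have h5 := sq_eq_one_of_commute hcd (Commute.refl c) hcd1 h4
          rw [pow_succ, h5, one_mul] at h3
          exact h.ne_one_three h3
        · exact hcd (commute_of_cube_eq_one h3 h4 hcd1)
    have hY : ∀ x y : ModularPSL, x ≠ 1 → Commute c x → Commute c y → Commute x y :=
      fun x y _ hx hy => commute_trans h.ne_one_two hx.symm hy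
    -- Moves merely permute the commuting a, b, c, so each of them can be put next to d.
    have h1 := h.of_equiv (HurwitzEquiv.move_one a b c d)
    rw [mul_assoc, hbc.eq, inv_mul_cancel_left] at h1
    have h2 := (h.of_equiv (HurwitzEquiv.move_zero a b c d))
    rw [mul_assoc, hab.eq, inv_mul_cancel_left] at h2
    have h3 := h2.of_equiv (HurwitzEquiv.move_one b a c d)
    rw [mul_assoc, hac.eq, inv_mul_cancel_left] at h3
    have fin : ∀ x, Commute c x → x ≠ 1 → Commute x (d * x * d⁻¹) ∧
        Commute x (d * (d * x * d⁻¹) * d⁻¹) := fun x hx hx1 =>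
      ⟨hY _ _ hx1 hx (hX _ hx), hY _ _ hx1 hx (hX _ (hX _ hx))⟩
    obtain ⟨a1, a2⟩ := fin a hac.symm h.ne_one_zero
    obtain ⟨b1, b2⟩ := fin b hbc.symm h.ne_one_one
    obtain ⟨c1, c2⟩ := fin c (Commute.refl c) h.ne_one_two
    exact ⟨a, b, c, d, HurwitzEquiv.refl _, hab, hac, hbc, hd, h3.conj_eq_inv had a1 a2 hd,
      h1.conj_eq_inv hbd b1 b2 hd, h.conj_eq_inv hcd c1 c2 hd⟩
  · left
    -- With p = d⁻¹cd this reaches (a, p, p⁻¹bp, p⁻¹dp), in which neither outer pair commutes.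
    have e := ((HurwitzEquiv.move_two a b c d).trans (HurwitzEquiv.move_two a b d _)).trans
      (HurwitzEquiv.move_one _ _ _ _)
    refine ((h.of_equiv e).isBraidType ?_ ?_).of_equiv e
    · intro hn
      exact hc (commute_trans h.ne_one_zero hac.symm hn)
    · rwa [commute_conj_iff]

/-- The entries are arranged in the cycle a, b, c, d. If two opposite edges of it both fail to
commute, the braid case applies, after a rotation if needed. Otherwise two adjacent edges commute,
and a rotation brings the three entries involved to the front. -/
theorem isBraidType_or_isDihedralType {s : Fin 4 → ModularPSL} (h : IsFiniteIrreducible s) :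
    IsBraidType s ∨ IsDihedralType s := by
  obtain ⟨a, b, c, d, rfl⟩ : ∃ a b c d, s = ![a, b, c, d] :=
    ⟨s 0, s 1, s 2, s 3, by ext i; fin_cases i <;> rfl⟩
  have e := HurwitzEquiv.rotate a b c d
  by_cases h1 : Commute a b ∨ Commute c d
  · by_cases h2 : Commute b c ∨ Commute d a
    · have key : ∀ t, HurwitzEquiv ![a, b, c, d] t → IsBraidType t ∨ IsDihedralType t →
          IsBraidType ![a, b, c, d] ∨ IsDihedralType ![a, b, c, d] := fun t ht h =>
        h.imp (fun h => h.of_equiv ht) fun h => h.of_equiv ht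
      rcases h1 with h1 | h1 <;> rcases h2 with h2 | h2
      · exact h.isBraidType_or_isDihedralType_of_commute h1 h2
      · refine key _ e ((h.of_equiv e).isBraidType_or_isDihedralType_of_commute ?_ ?_)
        · rwa [commute_conj_self_iff]
        · rwa [commute_conj_iff]
      · have e := HurwitzEquiv.rotate_inv a b c d
        exact key _ e ((h.of_equiv e).isBraidType_or_isDihedralType_of_commute h2 h1)
      · have e := e.trans (HurwitzEquiv.rotate _ _ _ _)
        refine key _ e ((h.of_equiv e).isBraidType_or_isDihedralType_of_commute ?_ ?_)
        · rw [commute_conj_self_iff, Commute.symm_iff, commute_conj_self_iff]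
          exact h1.symm
        · rw [commute_conj_iff, commute_conj_self_iff]
          exact h2
    · push Not at h2
      exact Or.inl (((h.of_equiv e).isBraidType (by rw [commute_conj_self_iff]; exact h2.2)
        (by rw [commute_conj_iff]; exact h2.1)).of_equiv e)
  · push Not at h1
    exact Or.inl (h.isBraidType h1.1 h1.2)

end IsFiniteIrreducible
end ModularPSL

/-! ### Enumeration of the orbit of the model system -/

namespace ModelOrbit

open BraidGroup

/-- The six braids that occur as entries in the orbit of the model system. -/
def atom : Fin 6 → BraidGroup 3 :=
  let c := (σ 3 1)⁻¹ * σ 3 0 * σ 3 1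
  let d := c⁻¹ * σ 3 0 * c
  ![σ 3 0, σ 3 1, c, d, d⁻¹ * σ 3 0 * d, c⁻¹ * d * c]

/-- The images of the atoms in `SL(2, ℤ)`. -/
def atomMat : Fin 6 → SL(2, ℤ) :=
  ![matA, matB, ⟨!![0, -1; 1, 2], by decide⟩, ⟨!![-1, -4; 1, 3], by decide⟩,
    ⟨!![-2, -9; 1, 4], by decide⟩, ⟨!![-5, -9; 4, 7], by decide⟩]

theorem toSL_conj (a b : BraidGroup 3) : toSL (a⁻¹ * b * a) = (toSL a)⁻¹ * toSL b * toSL a := by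
  rw [map_mul, map_mul, map_inv]

theorem toSL_atom (i : Fin 6) : toSL (atom i) = atomMat i := by
  have h0 : toSL (atom 0) = atomMat 0 := toSL_σ_zero
  have h1 : toSL (atom 1) = atomMat 1 := toSL_σ_one
  have h2 : toSL (atom 2) = atomMat 2 := by
    refine (toSL_conj (atom 1) (atom 0)).trans ?_
    rw [h0, h1]; decide
  have h3 : toSL (atom 3) = atomMat 3 := by
    refine (toSL_conj (atom 2) (atom 0)).trans ?_
    rw [h0, h2]; decide
  have h4 : toSL (atom 4) = atomMat 4 := by
    refine (toSL_conj (atom 3) (atom 0)).trans ?_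
    rw [h0, h3]; decide
  have h5 : toSL (atom 5) = atomMat 5 := by
    refine (toSL_conj (atom 2) (atom 3)).trans ?_
    rw [h2, h3]; decide
  match i with
  | 0 => exact h0
  | 1 => exact h1
  | 2 => exact h2
  | 3 => exact h3
  | 4 => exact h4
  | 5 => exact h5

theorem exponentSum_atom (i : Fin 6) : exponentSum (atom i) = 1 := by
  have h0 : exponentSum (atom 0) = 1 := exponentSum_σ _
  have h3 : exponentSum (atom 3) = 1 := (exponentSum_conj (atom 2) (atom 0)).trans h0
  match i with
  | 0 => exact h0
  | 1 => exact exponentSum_σ _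
  | 2 => exact (exponentSum_conj (atom 1) (atom 0)).trans h0
  | 3 => exact h3
  | 4 => exact (exponentSum_conj (atom 3) (atom 0)).trans h0
  | 5 => exact (exponentSum_conj (atom 2) (atom 3)).trans h3

theorem atom_injective : Function.Injective atom := by
  intro i j h
  have h1 := congrArg toSL h
  rw [toSL_atom, toSL_atom] at h1
  clear h
  revert i j
  decide

/-- The partial table of conjugates `(atom j)⁻¹ * atom i * atom j`. -/
def conjIndex : Fin 6 → Fin 6 → Option (Fin 6) :=
  ![![some 0, some 2, some 3, some 4, none, none],
    ![none, none, some 0, none, none, none],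
    ![some 1, none, some 2, some 0, none, some 3],
    ![some 2, none, some 5, some 3, some 0, none],
    ![some 3, none, none, none, none, none],
    ![none, none, none, some 2, none, none]]

/-- All atoms have exponent sum 1, so their images as integral matrices decide the identity. -/
theorem atom_conj {i j k : Fin 6} (h : conjIndex i j = some k) :
    (atom j)⁻¹ * atom i * atom j = atom k := by
  apply eq_of_toPSL_eq
  · apply congrArg ModularPSL.proj
    rw [map_mul, map_mul, map_inv, toSL_atom, toSL_atom, toSL_atom]
    revert i j k
    decide
  · rw [exponentSum_conj, exponentSum_atom, exponentSum_atom]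

/-- The index quadruples of systems whose entries are atoms. -/
abbrev Quad : Type := Fin 6 × Fin 6 × Fin 6 × Fin 6

/-- The system of atoms with the given indices. -/
def toSystem (q : Quad) : BraidSystem 3 4 := ![atom q.1, atom q.2.1, atom q.2.2.1, atom q.2.2.2]

theorem toSystem_injective : Function.Injective toSystem := by
  rintro ⟨a, b, c, d⟩ ⟨a', b', c', d'⟩ h
  exact Prod.ext (atom_injective (congrFun h 0)) (Prod.ext (atom_injective (congrFun h 1))
    (Prod.ext (atom_injective (congrFun h 2)) (atom_injective (congrFun h 3))))

/-- The elementary moves on index quadruples. -/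
def move : Fin 3 → Quad → Quad
  -- The default 0 is irrelevant: on `quads` the condition `IsValid` holds and the table entry
  -- exists.
  | 0, (a, b, c, d) => (b, (conjIndex a b).getD 0, c, d)
  | 1, (a, b, c, d) => (a, c, (conjIndex b c).getD 0, d)
  | 2, (a, b, c, d) => (a, b, d, (conjIndex c d).getD 0)

/-- The conjugate needed for a move is in the table. -/
def IsValid (q : Quad) : Prop :=
  (conjIndex q.1 q.2.1).isSome ∧ (conjIndex q.2.1 q.2.2.1).isSome ∧
    (conjIndex q.2.2.1 q.2.2.2).isSome

instance : DecidablePred IsValid := fun _ => inferInstanceAs (Decidable (_ ∧ _))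

theorem hurwitzMove_toSystem {q : Quad} (hq : IsValid q) (i : Fin 3) :
    hurwitzMove (n := 4) i (toSystem q) = toSystem (move i q) := by
  obtain ⟨a, b, c, d⟩ := q
  obtain ⟨h0, h1, h2⟩ := hq
  obtain ⟨k0, h0⟩ := Option.isSome_iff_exists.1 h0
  obtain ⟨k1, h1⟩ := Option.isSome_iff_exists.1 h1
  obtain ⟨k2, h2⟩ := Option.isSome_iff_exists.1 h2
  simp only at h0 h1 h2
  match i with
  | 0 => simp only [toSystem, move, h0, Option.getD_some, hurwitzMove_zero, atom_conj h0]
  | 1 => simp only [toSystem, move, h1, Option.getD_some, hurwitzMove_one, atom_conj h1]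
  | 2 => simp only [toSystem, move, h2, Option.getD_some, hurwitzMove_two, atom_conj h2]

/-- Words leading from the model system to every element of its orbit. -/
def words : List (List (Fin 3)) :=
  [[], [2], [2, 1], [2, 2], [2, 1, 0], [2, 1, 1], [2, 2, 1], [2, 1, 0, 0], [2, 1, 1, 0],
    [2, 1, 1, 2], [2, 2, 1, 0], [2, 2, 1, 1], [2, 1, 0, 0, 1], [2, 1, 1, 0, 0], [2, 1, 1, 0, 2],
    [2, 2, 1, 0, 0], [2, 2, 1, 1, 0], [2, 1, 0, 0, 1, 2], [2, 1, 1, 0, 0, 2], [2, 1, 1, 0, 2, 1],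
    [2, 2, 1, 0, 0, 1], [2, 2, 1, 1, 0, 0], [2, 1, 1, 0, 0, 2, 1], [2, 1, 1, 0, 2, 1, 1],
    [2, 2, 1, 0, 0, 1, 2], [2, 1, 1, 0, 2, 1, 1, 0], [2, 2, 1, 0, 0, 1, 2, 2]]

/-- The index quadruple reached by a word. -/
def run (w : List (Fin 3)) : Quad := w.foldl (fun q i => move i q) (0, 0, 0, 1)

/-- The index quadruples of the orbit of the model system. -/
def quads : List Quad := words.map run

theorem quads_nodup : quads.Nodup := by decide +kernel

theorem quads_closed : ∀ q ∈ quads, IsValid q ∧ ∀ i, move i q ∈ quads := by decide +kernel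

/-- A move has order three on (a, b) exactly when aba = bab. Hence inverse moves are squares of
moves, and closure under moves alone suffices. -/
theorem move_cube : ∀ q ∈ quads, ∀ i, move i (move i (move i q)) = q := by decide +kernel

theorem modelSystem_eq : modelSystem = toSystem (0, 0, 0, 1) := rfl

theorem hurwitzMove_cube {s : BraidSystem 3 4} (hs : ∃ q ∈ quads, s = toSystem q) (i : Fin 3) :
    hurwitzMove (n := 4) i (hurwitzMove (n := 4) i (hurwitzMove (n := 4) i s)) = s := by
  obtain ⟨q, hq, rfl⟩ := hs
  have h1 := (quads_closed q hq).2 i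
  have h2 := (quads_closed _ h1).2 i
  rw [hurwitzMove_toSystem (quads_closed q hq).1, hurwitzMove_toSystem (quads_closed _ h1).1,
    hurwitzMove_toSystem (quads_closed _ h2).1, move_cube q hq]

theorem exists_quad (b : BraidGroup 4) : ∃ q ∈ quads, hurwitz modelSystem b = toSystem q := by
  have hmove : ∀ (i : Fin 3) (s : BraidSystem 3 4), (∃ q ∈ quads, s = toSystem q) →
      ∃ q ∈ quads, hurwitzMove (n := 4) i s = toSystem q := by
    rintro i _ ⟨q, hq, rfl⟩
    exact ⟨_, (quads_closed q hq).2 i, hurwitzMove_toSystem (quads_closed q hq).1 i⟩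
  apply hurwitz_induction (n := 4) (p := fun s : BraidSystem 3 4 => ∃ q ∈ quads, s = toSystem q)
    hmove
  · intro i s hs
    rw [← hurwitzMove_cube hs i, Equiv.symm_apply_apply]
    exact hmove i _ (hmove i _ hs)
  · exact ⟨_, by decide +kernel, modelSystem_eq⟩

theorem toSystem_mem_orbit {q : Quad} (hq : q ∈ quads) :
    ∃ b : BraidGroup 4, hurwitz modelSystem b = toSystem q := by
  obtain ⟨w, -, rfl⟩ := List.mem_map.1 hq
  have key : ∀ (w : List (Fin 3)) (q : Quad), q ∈ quads →
      ∃ b : BraidGroup 4, hurwitz (toSystem q) b =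
        toSystem (w.foldl (fun q i => move i q) q) := by
    intro w
    induction w with
    | nil => exact fun q _ => ⟨1, hurwitz_one _⟩
    | cons i w ih =>
      intro q hq
      obtain ⟨b, hb⟩ := ih (move i q) ((quads_closed q hq).2 i)
      refine ⟨σ 4 i * b, ?_⟩
      rw [hurwitz_mul, hurwitz_σ, hurwitzMove_toSystem (quads_closed q hq).1, hb]
      rfl
  rw [modelSystem_eq]
  exact key w _ (by decide +kernel)

theorem sq_mem_pureBraidGroup (n : ℕ) (i : Fin (n - 1)) : σ n i * σ n i ∈ pureBraidGroup n := by
  have h : toPerm n (σ n i) = Equiv.swap (lo i) (hi i) := lift_σ _ _ _ _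
  rw [pureBraidGroup, MonoidHom.mem_ker, map_mul, h, Equiv.swap_mul_self]

/-- On this orbit σᵢ³ acts trivially, so σᵢ acts as the pure braid σᵢ⁻², and σᵢ⁻¹ as σᵢ². -/
theorem exists_pure (b : BraidGroup 4) :
    ∃ p ∈ pureBraidGroup 4, hurwitz modelSystem p = hurwitz modelSystem b := by
  induction b using BraidGroup.induction_right with
  | one => exact ⟨1, one_mem _, rfl⟩
  | mul b i ih =>
    obtain ⟨p, hp, h⟩ := ih
    refine ⟨p * (σ 4 i * σ 4 i)⁻¹, mul_mem hp (inv_mem (sq_mem_pureBraidGroup 4 i)), ?_⟩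
    rw [hurwitz_mul, hurwitz_mul, h, mul_inv_rev, hurwitz_mul, hurwitz_σ_inv, hurwitz_σ_inv,
      hurwitz_σ, Equiv.symm_apply_eq, Equiv.symm_apply_eq]
    exact (hurwitzMove_cube (exists_quad b) i).symm
  | inv b i ih =>
    obtain ⟨p, hp, h⟩ := ih
    refine ⟨p * (σ 4 i * σ 4 i), mul_mem hp (sq_mem_pureBraidGroup 4 i), ?_⟩
    rw [hurwitz_mul, hurwitz_mul, h, hurwitz_mul, hurwitz_σ, hurwitz_σ, hurwitz_σ_inv,
      Equiv.eq_symm_apply]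
    exact hurwitzMove_cube (exists_quad b) i

theorem range_hurwitz_modelSystem :
    Set.range (hurwitz modelSystem) = toSystem '' (quads.toFinset : Set Quad) := by
  ext s
  constructor
  · rintro ⟨b, rfl⟩
    obtain ⟨q, hq, h⟩ := exists_quad b
    exact ⟨q, by simpa using hq, h.symm⟩
  · rintro ⟨q, hq, rfl⟩
    exact toSystem_mem_orbit (by simpa using hq)

theorem ncard_range_hurwitz_modelSystem : (Set.range (hurwitz modelSystem)).ncard = 27 := by
  rw [range_hurwitz_modelSystem, Set.ncard_image_of_injective _ toSystem_injective,
    Set.ncard_coe_finset, List.toFinset_card_of_nodup quads_nodup]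
  rfl

theorem pureHurwitzOrbit_modelSystem :
    pureHurwitzOrbit modelSystem = Set.range (hurwitz modelSystem) := by
  ext s
  constructor
  · rintro ⟨p, -, rfl⟩
    exact ⟨p, rfl⟩
  · rintro ⟨b, rfl⟩
    obtain ⟨p, hp, h⟩ := exists_pure b
    exact ⟨p, hp, h.symm⟩

theorem finite_range_hurwitz_modelSystem : (Set.range (hurwitz modelSystem)).Finite := by
  rw [range_hurwitz_modelSystem]
  exact (Finset.finite_toSet _).image _

/-- The orbit of the model system contains an alternating system. -/
theorem exists_alternating : ∃ b : BraidGroup 4, hurwitz modelSystem b =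
    ![σ 3 0, (σ 3 1)⁻¹ * σ 3 0 * σ 3 1, σ 3 0, (σ 3 1)⁻¹ * σ 3 0 * σ 3 1] :=
  toSystem_mem_orbit (q := (0, 2, 0, 2)) (by decide +kernel)

end ModelOrbit

open BraidGroup ModularPSL

/-! ### The invariant product and the count for dihedral systems -/

section Product

variable {G : Type*} [Group G]

theorem eq_vec_four {α : Type*} (t : Fin 4 → α) : t = ![t 0, t 1, t 2, t 3] := by
  ext i; fin_cases i <;> rfl

/-- The ordered product of the entries of a quadruple. -/
def tupleProd (t : Fin 4 → G) : G := t 0 * t 1 * t 2 * t 3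

theorem tupleProd_hurwitzMove (i : Fin 3) (t : Fin 4 → G) :
    tupleProd (hurwitzMove (n := 4) i t) = tupleProd t := by
  rw [eq_vec_four t]
  match i with
  | 0 => rw [hurwitzMove_zero]; simp [tupleProd, mul_assoc]
  | 1 => rw [hurwitzMove_one]; simp [tupleProd, mul_assoc]
  | 2 => rw [hurwitzMove_two]; simp [tupleProd, mul_assoc]

theorem tupleProd_hurwitz (t : Fin 4 → G) (b : BraidGroup 4) :
    tupleProd (hurwitz t b) = tupleProd t := by
  apply hurwitz_induction (n := 4) (p := fun u : Fin 4 → G => tupleProd u = tupleProd t)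
  · intro i u hu
    rw [tupleProd_hurwitzMove, hu]
  · intro i u hu
    rw [← hu, ← tupleProd_hurwitzMove i, Equiv.apply_symm_apply]
  · rfl

/-- Sets of labelled elements that are stable under conjugation by elements with another label
give a set of tuples that is stable under the Hurwitz action. -/
theorem hurwitz_mem_labelled {n : ℕ} {L : Fin n → Set G}
    (h1 : ∀ j l, j ≠ l → ∀ g ∈ L j, ∀ h ∈ L l, h⁻¹ * g * h ∈ L j)
    (h2 : ∀ j l, j ≠ l → ∀ g ∈ L j, ∀ h ∈ L l, h * g * h⁻¹ ∈ L j)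
    {t : Fin n → G} (ht : ∃ π : Equiv.Perm (Fin n), ∀ k, t k ∈ L (π k)) (b : BraidGroup n) :
    ∃ π : Equiv.Perm (Fin n), ∀ k, hurwitz t b k ∈ L (π k) := by
  have hne : ∀ i : Fin (n - 1), lo i ≠ hi i := fun i => by simp [lo, hi, Fin.ext_iff]
  apply hurwitz_induction (p := fun t : Fin n → G => ∃ π : Equiv.Perm (Fin n), ∀ k, t k ∈ L (π k))
    _ _ ht
  · rintro i t ⟨π, hπ⟩
    refine ⟨π * Equiv.swap (lo i) (hi i), fun k => ?_⟩
    rw [hurwitzMove_apply, Equiv.Perm.mul_apply]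
    split_ifs with hk hk'
    · rw [hk, Equiv.swap_apply_left]; exact hπ _
    · rw [hk', Equiv.swap_apply_right]
      exact h1 _ _ (fun h => hne i (π.injective h)) _ (hπ _) _ (hπ _)
    · rw [Equiv.swap_apply_of_ne_of_ne hk hk']; exact hπ _
  · rintro i t ⟨π, hπ⟩
    refine ⟨π * Equiv.swap (lo i) (hi i), fun k => ?_⟩
    rw [hurwitzMove_symm_apply, Equiv.Perm.mul_apply]
    split_ifs with hk hk'
    · rw [hk, Equiv.swap_apply_left]
      exact h2 _ _ (fun h => hne i (π.injective h.symm)) _ (hπ _) _ (hπ _)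
    · rw [hk', Equiv.swap_apply_right]; exact hπ _
    · rw [Equiv.swap_apply_of_ne_of_ne hk hk']; exact hπ _

/-- The labels of a dihedral system: three commuting pairs of elements, and the elements that swap
each of the pairs by conjugation. -/
def dihedralLabel (x : Fin 3 → Bool → G) : Fin 4 → Set G :=
  Fin.snoc (α := fun _ => Set G) (fun i => Set.range (x i))
    {w | ∀ i e, w⁻¹ * x i e * w = x i (!e)}

theorem dihedralLabel_castSucc (x : Fin 3 → Bool → G) (i : Fin 3) :
    dihedralLabel x i.castSucc = Set.range (x i) := Fin.snoc_castSucc (α := fun _ => Set G) _ _ _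

theorem dihedralLabel_last (x : Fin 3 → Bool → G) :
    dihedralLabel x (Fin.last 3) = {w | ∀ i e, w⁻¹ * x i e * w = x i (!e)} :=
  Fin.snoc_last (α := fun _ => Set G) _ _

/-- Paired elements commute with each other and are exchanged by swapping elements. Conjugating a
swapping element by something that commutes with every pair leaves its effect on the pairs
unchanged. -/
theorem dihedralLabel_conj {x : Fin 3 → Bool → G} (hx : ∀ i j e f, Commute (x i e) (x j f))
    (j l : Fin 4) (hjl : j ≠ l) (g : G) (hg : g ∈ dihedralLabel x j) (h : G)
    (hh : h ∈ dihedralLabel x l) :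
    h⁻¹ * g * h ∈ dihedralLabel x j ∧ h * g * h⁻¹ ∈ dihedralLabel x j := by
  induction j using Fin.lastCases with
  | last =>
    induction l using Fin.lastCases with
    | last => exact absurd rfl hjl
    | cast l =>
      rw [dihedralLabel_last] at *
      rw [dihedralLabel_castSucc] at hh
      obtain ⟨f, rfl⟩ := hh
      have key : ∀ y : G, (∀ j e, Commute y (x j e)) →
          y⁻¹ * g * y ∈ {w | ∀ i e, w⁻¹ * x i e * w = x i (!e)} := by
        intro y hy i e
        have h1 : y * x i e * y⁻¹ = x i e := by rw [(hy i e).eq, mul_inv_cancel_right]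
        calc (y⁻¹ * g * y)⁻¹ * x i e * (y⁻¹ * g * y) =
            y⁻¹ * (g⁻¹ * (y * x i e * y⁻¹) * g) * y := by group
          _ = x i (!e) := by
            rw [h1, hg i e, mul_assoc, ← (hy i _).eq, inv_mul_cancel_left]
      refine ⟨key _ fun j e => hx _ _ _ _, ?_⟩
      have := key (x l f)⁻¹ fun j e => (hx _ _ _ _).inv_left
      rwa [inv_inv] at this
  | cast j =>
    rw [dihedralLabel_castSucc] at *
    obtain ⟨e, rfl⟩ := hg
    induction l using Fin.lastCases with
    | last =>
      rw [dihedralLabel_last] at hh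
      refine ⟨⟨!e, (hh j e).symm⟩, ⟨!e, ?_⟩⟩
      have := hh j (!e)
      rw [Bool.not_not] at this
      rw [← this]; group
    | cast l =>
      rw [dihedralLabel_castSucc] at hh
      obtain ⟨f, rfl⟩ := hh
      refine ⟨⟨e, ?_⟩, ⟨e, ?_⟩⟩
      · rw [mul_assoc, (hx j l e f).eq, inv_mul_cancel_left]
      · rw [(hx l j f e).eq, mul_inv_cancel_right]

theorem eq_of_tupleProd_eq {t u : Fin 4 → G} (h : tupleProd t = tupleProd u) (l : Fin 4)
    (hl : ∀ k, k ≠ l → t k = u k) : t = u := by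
  have hl' : t l = u l := by
    unfold tupleProd at h
    fin_cases l
    · have h1 := hl 1 (by decide); have h2 := hl 2 (by decide); have h3 := hl 3 (by decide)
      rw [h1, h2, h3] at h
      simpa using h
    · have h1 := hl 0 (by decide); have h2 := hl 2 (by decide); have h3 := hl 3 (by decide)
      rw [h1, h2, h3] at h
      simpa using h
    · have h1 := hl 0 (by decide); have h2 := hl 1 (by decide); have h3 := hl 3 (by decide)
      rw [h1, h2, h3] at h
      simpa using h
    · have h1 := hl 0 (by decide); have h2 := hl 1 (by decide); have h3 := hl 2 (by decide)
      rw [h1, h2, h3] at h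
      simpa using h
  funext k
  by_cases hk : k = l
  · rw [hk, hl']
  · exact hl k hk

/-- A system of three commuting elements and an element that swaps each of them with a partner
has at most `192` elements in its orbit. -/
theorem ncard_range_hurwitz_le_of_dihedral {x : Fin 3 → Bool → G}
    (hx : ∀ i j e f, Commute (x i e) (x j f)) {t : Fin 4 → G}
    (ht : ∀ k, t k ∈ dihedralLabel x k) : (Set.range (hurwitz t)).ncard ≤ 192 := by
  -- The code of a tuple is the position of each label and the member chosen from each pair; the
  -- entry with the last label is recovered from the invariant product. There are 4! · 2³ = 192
  -- codes.
  have h1 : ∀ u : Set.range (hurwitz t), ∃ p : Equiv.Perm (Fin 4) × (Fin 3 → Bool),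
      ∀ i : Fin 3, (u : Fin 4 → G) (p.1⁻¹ i.castSucc) = x i (p.2 i) := by
    rintro ⟨_, b, rfl⟩
    obtain ⟨π, hπ⟩ := hurwitz_mem_labelled (L := dihedralLabel x)
      (fun j l hjl g hg h hh => (dihedralLabel_conj hx j l hjl g hg h hh).1)
      (fun j l hjl g hg h hh => (dihedralLabel_conj hx j l hjl g hg h hh).2) ⟨1, ht⟩ b
    have h2 : ∀ i : Fin 3, ∃ e, hurwitz t b (π⁻¹ i.castSucc) = x i e := by
      intro i
      have := hπ (π⁻¹ i.castSucc)
      rw [show π (π⁻¹ i.castSucc) = i.castSucc from π.apply_symm_apply _,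
        dihedralLabel_castSucc] at this
      obtain ⟨e, he⟩ := this
      exact ⟨e, he.symm⟩
    choose ε hε using h2
    exact ⟨⟨π, ε⟩, hε⟩
  choose F hF using h1
  have hinj : Function.Injective F := by
    intro u v huv
    apply Subtype.ext
    have hu := hF u
    have hv := hF v
    rw [← huv] at hv
    have hp : ∀ w : Set.range (hurwitz t), tupleProd (w : Fin 4 → G) = tupleProd t := by
      rintro ⟨_, b, rfl⟩
      exact tupleProd_hurwitz t b
    refine eq_of_tupleProd_eq ((hp u).trans (hp v).symm) ((F u).1⁻¹ (Fin.last 3)) fun k hk => ?_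
    obtain ⟨j, rfl⟩ := (F u).1⁻¹.surjective k
    induction j using Fin.lastCases with
    | last => exact absurd rfl hk
    | cast i => rw [hu, hv]
  have := Nat.card_le_card_of_injective F hinj
  rw [Nat.card_coe_set_eq, Nat.card_prod, Nat.card_perm, Nat.card_fun] at this
  exact this.trans_eq (by simp [Nat.factorial])

end Product

/-! ### Return to braid systems of degree three -/

theorem hurwitzOrbit_eq_range {m n : ℕ} (s : BraidSystem m n) :
    hurwitzOrbit s = Set.range (hurwitz s) := by
  ext x
  exact ⟨fun ⟨b, hb⟩ => ⟨b, hb.symm⟩, fun ⟨b, hb⟩ => ⟨b, hb.symm⟩⟩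

theorem range_hurwitz_hurwitz {G : Type*} [Group G] {n : ℕ} (s : Fin n → G) (b : BraidGroup n) :
    Set.range (hurwitz (hurwitz s b)) = Set.range (hurwitz s) := by
  ext x
  constructor
  · rintro ⟨c, rfl⟩
    exact ⟨b * c, hurwitz_mul _ _ _⟩
  · rintro ⟨c, rfl⟩
    exact ⟨b⁻¹ * c, by rw [← hurwitz_mul, mul_inv_cancel_left]⟩

theorem exponentSum_hurwitz {m n : ℕ} (s : BraidSystem m n) (b : BraidGroup n) (k : Fin n) :
    exponentSum (hurwitz s b k) = exponentSum (s (toPerm n b k)) := by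
  have hσ : ∀ i, toPerm n (σ n i) = Equiv.swap (lo i) (hi i) := fun i => lift_σ _ _ _ _
  induction b using BraidGroup.induction_right generalizing k with
  | one => rw [hurwitz_one, map_one, Equiv.Perm.one_apply]
  | mul b i ih =>
    rw [hurwitz_mul, hurwitz_σ, hurwitzMove_apply, map_mul, hσ, Equiv.Perm.mul_apply]
    split_ifs with hk hk'
    · rw [hk, Equiv.swap_apply_left, ih]
    · rw [hk', Equiv.swap_apply_right, exponentSum_conj, ih]
    · rw [Equiv.swap_apply_of_ne_of_ne hk hk', ih]
  | inv b i ih =>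
    rw [hurwitz_mul, hurwitz_σ_inv, hurwitzMove_symm_apply, map_mul, map_inv, hσ, Equiv.swap_inv,
      Equiv.Perm.mul_apply]
    split_ifs with hk hk'
    · have := exponentSum_conj (hurwitz s b (lo i))⁻¹ (hurwitz s b (hi i))
      rw [inv_inv] at this
      rw [hk, Equiv.swap_apply_left, this, ih]
    · rw [hk', Equiv.swap_apply_right, ih]
    · rw [Equiv.swap_apply_of_ne_of_ne hk hk', ih]

theorem eq_of_toPSL_comp_eq {s t : BraidSystem 3 4} (h : toPSL ∘ s = toPSL ∘ t)
    (he : ∀ k, exponentSum (s k) = exponentSum (t k)) : s = t :=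
  funext fun k => eq_of_toPSL_eq (congrFun h k) (he k)

/-- An entry trivial in PSL(2, ℤ) is central and would split off, and commutation in PSL(2, ℤ) lifts
to `B_3`. -/
theorem isFiniteIrreducible_toPSL {s : BraidSystem 3 4} (hs : ¬ s.IsReducible)
    (hfin : (hurwitzOrbit s).Finite) : IsFiniteIrreducible (toPSL ∘ s) := by
  refine ⟨?_, ?_, ?_⟩
  · rw [hurwitzOrbit_eq_range] at hfin
    have : Set.range (hurwitz (toPSL ∘ s)) = (toPSL ∘ ·) '' Set.range (hurwitz s) := by
      rw [← Set.range_comp]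
      congr 1
      funext b
      exact hurwitz_map toPSL s b
    rw [HasFiniteOrbit, this]
    exact hfin.image _
  · intro i hi
    apply hs
    refine ⟨{i}, ⟨i, rfl⟩, ⟨i + 1, by simp⟩, ?_⟩
    rintro _ rfl j -
    exact commute_of_toPSL_eq_one hi (s j)
  · intro hc
    apply hs
    exact ⟨{0}, ⟨0, rfl⟩, ⟨1, by simp⟩, fun i _ j _ => commute_of_toPSL (hc i j)⟩

/-- A system of braid type is, modulo the centre, the image of a system in the orbit of the model
system. -/
theorem ModularPSL.IsBraidType.exists_hom {s : Fin 4 → ModularPSL} (h : IsBraidType s) :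
    ∃ (φ : BraidGroup 3 →* ModularPSL) (q : BraidGroup 4), q ∈ pureBraidGroup 4 ∧
      s = φ ∘ hurwitz modelSystem q := by
  obtain ⟨u, v, h1, h2⟩ := h
  -- The image of σ₂ is chosen so that σ₂⁻¹σ₁σ₂ maps to v, which matches the alternating system in
  -- the model orbit.
  let φ := liftThree u (u⁻¹ * v * u) (by
    calc u * (u⁻¹ * v * u) * u = u⁻¹ * (u * v * u) * u := by group
      _ = u⁻¹ * (v * u * v) * u := by rw [h2]
      _ = u⁻¹ * v * u * u * (u⁻¹ * v * u) := by group)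
  have e0 : φ (σ 3 0) = u := liftThree_σ_zero _ _ _
  have e1 : φ (σ 3 1) = u⁻¹ * v * u := liftThree_σ_one _ _ _
  have e2 : φ ((σ 3 1)⁻¹ * σ 3 0 * σ 3 1) = v := by
    rw [map_mul, map_mul, map_inv, e0, e1]
    calc (u⁻¹ * v * u)⁻¹ * u * (u⁻¹ * v * u) = u⁻¹ * v⁻¹ * (u * v * u) := by group
      _ = v := by rw [h2]; group
  obtain ⟨b, hb⟩ := ModelOrbit.exists_alternating
  have h3 : HurwitzEquiv (φ ∘ modelSystem) ![u, v, u, v] := by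
    refine ⟨b, ?_⟩
    rw [hurwitz_map, hb]
    funext k
    fin_cases k
    exacts [e0, e2, e0, e2]
  obtain ⟨c, hc⟩ := h3.trans h1.symm
  obtain ⟨q, hq, hqc⟩ := ModelOrbit.exists_pure c
  exact ⟨φ, q, hq, by rw [hqc, ← hc, hurwitz_map]⟩

theorem ncard_hurwitzOrbit_le_of_isBraidType {s : BraidSystem 3 4}
    (h : IsBraidType (toPSL ∘ s)) : (hurwitzOrbit s).ncard ≤ 648 := by
  obtain ⟨φ, q, -, hq⟩ := h.exists_hom
  rw [hurwitzOrbit_eq_range]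
  let A : Set (Fin 4 → ModularPSL) := (φ ∘ ·) '' Set.range (hurwitz modelSystem)
  let B : Set (Fin 4 → ℤ) := (fun π : Equiv.Perm (Fin 4) => fun k => exponentSum (s (π k))) ''
    Set.univ
  have hA : A.ncard ≤ 27 :=
    (Set.ncard_image_le ModelOrbit.finite_range_hurwitz_modelSystem).trans_eq
      ModelOrbit.ncard_range_hurwitz_modelSystem
  have hAf : A.Finite := ModelOrbit.finite_range_hurwitz_modelSystem.image _
  have hB : B.ncard ≤ 24 := by
    refine (Set.ncard_image_le Set.finite_univ).trans_eq ?_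
    rw [Set.ncard_univ, Nat.card_perm]
    simp [Nat.factorial]
  have hBf : B.Finite := Set.finite_univ.image _
  let F : BraidSystem 3 4 → (Fin 4 → ModularPSL) × (Fin 4 → ℤ) :=
    fun t => (toPSL ∘ t, fun k => exponentSum (t k))
  have hF : Function.Injective F := fun t u htu =>
    eq_of_toPSL_comp_eq (congrArg Prod.fst htu) (congrFun (congrArg Prod.snd htu))
  -- The modular image runs through a quotient of the model orbit, and the exponent sums through
  -- rearrangements of those of s.
  have hsub : F '' Set.range (hurwitz s) ⊆ A ×ˢ B := by
    rintro _ ⟨_, ⟨b, rfl⟩, rfl⟩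
    refine ⟨⟨hurwitz modelSystem (q * b), ⟨_, rfl⟩, ?_⟩, ⟨toPerm 4 b, trivial, ?_⟩⟩
    · change φ ∘ _ = toPSL ∘ hurwitz s b
      rw [hurwitz_mul, ← hurwitz_map, ← hq, hurwitz_map]
    · funext k
      exact (exponentSum_hurwitz s b k).symm
  calc (Set.range (hurwitz s)).ncard = (F '' Set.range (hurwitz s)).ncard :=
        (Set.ncard_image_of_injective _ hF).symm
    _ ≤ (A ×ˢ B).ncard := Set.ncard_le_ncard hsub (hAf.prod hBf)
    _ = A.ncard * B.ncard := Set.ncard_prod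
    _ ≤ 27 * 24 := Nat.mul_le_mul hA hB
    _ = 648 := rfl

/-- The map sends the model moved by p to s moved by q⁻¹p. It is well defined because the modular
image depends only on the moved model, and pure braids keep each exponent sum in place. -/
theorem pureOrbitIsQuotient_of_isBraidType {s : BraidSystem 3 4}
    (h : IsBraidType (toPSL ∘ s)) : PureOrbitIsQuotient s modelSystem := by
  classical
  obtain ⟨φ, q, hq, hs⟩ := h.exists_hom
  have hwd : ∀ p ∈ pureBraidGroup 4, ∀ p' ∈ pureBraidGroup 4,
      hurwitz modelSystem p = hurwitz modelSystem p' →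
      hurwitz s (q⁻¹ * p) = hurwitz s (q⁻¹ * p') := by
    intro p hp p' hp' he
    apply eq_of_toPSL_comp_eq
    · rw [← hurwitz_map, ← hurwitz_map, hs, hurwitz_map, hurwitz_map, ← hurwitz_mul, ← hurwitz_mul,
        mul_inv_cancel_left, mul_inv_cancel_left, he]
    · intro k
      have h1 : ∀ p ∈ pureBraidGroup 4, toPerm 4 (q⁻¹ * p) = 1 := fun p hp =>
        (pureBraidGroup 4).mul_mem (inv_mem hq) hp
      rw [exponentSum_hurwitz, exponentSum_hurwitz, h1 p hp, h1 p' hp']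
  let f : BraidSystem 3 4 → BraidSystem 3 4 := fun x =>
    if hx : ∃ p ∈ pureBraidGroup 4, x = hurwitz modelSystem p then hurwitz s (q⁻¹ * hx.choose)
    else s
  have hf : ∀ p ∈ pureBraidGroup 4, f (hurwitz modelSystem p) = hurwitz s (q⁻¹ * p) := by
    intro p hp
    have hx : ∃ p' ∈ pureBraidGroup 4, hurwitz modelSystem p = hurwitz modelSystem p' :=
      ⟨p, hp, rfl⟩
    change dite _ _ _ = _
    rw [dif_pos hx]
    exact hwd _ hx.choose_spec.1 _ hp hx.choose_spec.2.symm
  refine ⟨f, ?_, ?_⟩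
  · ext y
    constructor
    · rintro ⟨_, ⟨p, hp, rfl⟩, rfl⟩
      exact ⟨q⁻¹ * p, mul_mem (inv_mem hq) hp, hf p hp⟩
    · rintro ⟨p, hp, rfl⟩
      refine ⟨hurwitz modelSystem (q * p), ⟨q * p, mul_mem hq hp, rfl⟩, ?_⟩
      rw [hf _ (mul_mem hq hp), inv_mul_cancel_left]
  · rintro _ ⟨p, hp, rfl⟩ p' hp'
    rw [← hurwitz_mul, hf _ (mul_mem hp hp'), hf _ hp, ← hurwitz_mul, mul_assoc]

theorem ncard_hurwitzOrbit_le_of_isDihedralType {s : BraidSystem 3 4}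
    (h : IsDihedralType (toPSL ∘ s)) : (hurwitzOrbit s).ncard ≤ 648 := by
  obtain ⟨a, b, c, d, ⟨β, hβ⟩, hab, hac, hbc, hd, ha, hb, hc⟩ := h
  rw [hurwitzOrbit_eq_range, ← range_hurwitz_hurwitz s β]
  rw [hurwitz_map] at hβ
  generalize hurwitz s β = t at hβ
  let y : Fin 3 → ModularPSL := ![a, b, c]
  have hy : ∀ i : Fin 3, toPSL (t i.castSucc) = y i := by
    intro i
    have := congrFun hβ i.castSucc
    fin_cases i <;> exact this
  have hy3 : toPSL (t (Fin.last 3)) = d := congrFun hβ (Fin.last 3)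
  have hyc : ∀ i j, Commute (y i) (y j) := by
    intro i j
    fin_cases i <;> fin_cases j <;>
      first | exact Commute.refl _ | assumption | (apply Commute.symm; assumption)
  have hyd : ∀ i, d⁻¹ * y i * d = (y i)⁻¹ := by
    intro i
    fin_cases i <;> assumption
  -- In `B_3` the partner of an entry is its conjugate by the last entry, not its inverse. A second
  -- conjugation returns to the entry, since d² = 1 and exponent sums agree.
  let x : Fin 3 → Bool → BraidGroup 3 := fun i e =>
    if e then (t (Fin.last 3))⁻¹ * t i.castSucc * t (Fin.last 3) else t i.castSucc
  have hx0 : ∀ i, toPSL (x i false) = y i := hy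
  have hx1 : ∀ i, toPSL (x i true) = (y i)⁻¹ := by
    intro i
    change toPSL ((t (Fin.last 3))⁻¹ * t i.castSucc * t (Fin.last 3)) = _
    rw [map_mul, map_mul, map_inv, hy, hy3, hyd]
  have hxc : ∀ i j e f, Commute (x i e) (x j f) := by
    intro i j e f
    apply commute_of_toPSL
    cases e <;> cases f <;> simp only [hx0, hx1]
    · exact hyc i j
    · exact (hyc i j).inv_right
    · exact (hyc i j).inv_left
    · exact (hyc i j).inv_inv
  refine (ncard_range_hurwitz_le_of_dihedral hxc (t := t) ?_).trans (by norm_num)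
  intro k
  induction k using Fin.lastCases with
  | cast i => rw [dihedralLabel_castSucc]; exact ⟨false, rfl⟩
  | last =>
    rw [dihedralLabel_last]
    intro i e
    cases e
    · rfl
    · apply eq_of_toPSL_eq
      · rw [map_mul, map_mul, map_inv, hx1, hy3, Bool.not_true, hx0, ← hyd i]
        have hdi : d⁻¹ = d := inv_eq_of_mul_eq_one_right (by rw [← sq, hd])
        rw [hdi]
        calc d * (d * y i * d) * d = d ^ 2 * y i * d ^ 2 := by simp only [sq, mul_assoc]
          _ = y i := by rw [hd, one_mul, mul_one]
      · rw [exponentSum_conj]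
        exact exponentSum_conj _ _

/-- The involution d inverts abc, so (abcd)² = 1. The squared product in `B_3` is thus a power of
Δ², whence 2e = 6k. -/
theorem three_dvd_of_isDihedralType {s : BraidSystem 3 4} (h : IsDihedralType (toPSL ∘ s)) :
    (3 : ℤ) ∣ ∑ i, exponentSum (s i) := by
  obtain ⟨a, b, c, d, ⟨β, hβ⟩, hab, hac, hbc, hd, ha, hb, hc⟩ := h
  have h1 : toPSL (tupleProd s ^ 2) = 1 := by
    have h2 : toPSL (tupleProd s) = tupleProd (toPSL ∘ s) := by
      simp only [tupleProd, map_mul, Function.comp_apply]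
    have hdi : d⁻¹ = d := inv_eq_of_mul_eq_one_right (by rw [← sq, hd])
    rw [map_pow, h2, ← tupleProd_hurwitz _ β, hβ]
    have h3 : d⁻¹ * (a * b * c) * d = (a * b * c)⁻¹ := by
      calc d⁻¹ * (a * b * c) * d = (d⁻¹ * a * d) * (d⁻¹ * b * d) * (d⁻¹ * c * d) := by group
        _ = (a * b * c)⁻¹ := by
          rw [ha, hb, hc, hab.eq, mul_inv_rev, mul_inv_rev, ← mul_assoc]
          have := ((hac.mul_left hbc).inv_inv).eq
          rw [hab.eq, mul_inv_rev, ← mul_assoc] at this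
          rw [← this, mul_assoc]
    change (a * b * c * d) ^ 2 = 1
    have h4 : (a * b * c * d) ^ 2 = a * b * c * (d⁻¹ * (a * b * c) * d) := by
      rw [sq, hdi]; simp only [mul_assoc]
    rw [h4, h3, mul_inv_cancel]
  obtain ⟨k, hk⟩ := eq_zpow_of_toPSL_eq_one h1
  have h2 := congrArg exponentSum hk
  rw [exponentSum_Δ₃_sq_zpow, sq, exponentSum_mul] at h2
  have h3 : exponentSum (tupleProd s) = ∑ i, exponentSum (s i) := by
    rw [Fin.sum_univ_four, tupleProd, exponentSum_mul, exponentSum_mul, exponentSum_mul]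
  rw [← h3]
  omega

theorem mainTheorem8 :
    (∀ s : BraidSystem 3 4, ¬ s.IsReducible → (hurwitzOrbit s).Finite →
      (hurwitzOrbit s).ncard ≤ 648 ∧
      (¬ (3 : ℤ) ∣ ∑ i, (s i).exponentSum → PureOrbitIsQuotient s modelSystem)) ∧
    (pureHurwitzOrbit modelSystem).ncard = 27 := by
  refine ⟨fun s hs hfin => ?_, ?_⟩
  · rcases (isFiniteIrreducible_toPSL hs hfin).isBraidType_or_isDihedralType with h | h
    · exact ⟨ncard_hurwitzOrbit_le_of_isBraidType h, fun _ =>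
        pureOrbitIsQuotient_of_isBraidType h⟩
    · exact ⟨ncard_hurwitzOrbit_le_of_isDihedralType h, fun h3 =>
        absurd (three_dvd_of_isDihedralType h) h3⟩
  · rw [ModelOrbit.pureHurwitzOrbit_modelSystem, ModelOrbit.ncard_range_hurwitz_modelSystem]
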